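/- Let $R$ be a commutative ring with $1$, let $H$ be a Hopf $R$-algebra (not necessarily commutative or cocommutative) whose underlying $R$-module is free of finite rank $n$, and let $A$ be an associative unital $R$-algebra. Write $\Delta(h)=\sum h_1\otimes h_2$. Let $H\otimes_R A\to A$, $h\otimes a\mapsto ha$, be a weak left $H$-action, i.e. an $R$-linear map with $h(ab)=\sum (h_1a)(h_2b)$, $h1_A=\varepsilon(h)1_A$ and $1_Ha=a$ for all $h\in H$, $a,b\in A$. Let $\sigma:H\otimes_R H\to A$ be an $R$-linear map. Suppose that $A\#_\sigma H$ is a right $H$-crossed product, i.e. that $A\otimes_R H$ with the multiplication $$(a\#_\sigma h)(a'\#_\sigma k)=\sum a\,(h_1a')\,\sigma(h_2\otimes k_1)\,\#_\sigma\, h_3k_2$$ is an associative $R$-algebra with unity $1_A\#_\sigma 1_H$, and suppose that $\sigma$ is invertible for the convolution product of $\mathrm{Hom}_R(H\otimes_R H,A)$. Then $B:=A\#_\sigma H$ is a right $H$-comodule algebra with coaction $\mathrm{id}_A\otimes\Delta$, $b\mapsto\sum b_{<0>}\otimes b_{<1>}$. Let $H^*=\mathrm{Hom}_R(H,R)$ with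 the convolution product $\star$ and the right $H$-action $(fh)(k)=f(hk)$, and let $B\#H^*$ be the $R$-module $B\otimes_R H^*$ with the multiplication $$(b\#f)(b'\#f')=\sum b\,b'_{<0>}\,\#\,(f b'_{<1>})\star f'$$ and unity $1_B\#\varepsilon$, which is an associative $R$-algebra. Then there are isomorphisms of $R$-algebras $$(A\#_\sigma H)\#H^*\;\simeq\; A\otimes_R M_n(R)\;\simeq\; M_n(A).$$ -/

import Mathlib

open scoped TensorProduct

noncomputable section

namespace HopfCrossed

open TensorProduct Coalgebra WithConv

section CrossedProducts

variable (R H A : Type*) [CommRing R] [Ring H] [Bialgebra R H] [Ring A] [Algebra R A]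

/-- A weak left action of an `R`-bialgebra `H` on an `R`-algebra `A`: an `R`-bilinear map
`(h, a) ↦ h a` such that `a ↦ (h ↦ h a)` is a morphism of `R`-algebras from `A` to `Hom_R(H, A)`
with the convolution product (so `h (a b) = ∑ (h₁ a) (h₂ b)` and `h 1 = ε(h) 1`), and
`1 a = a`. -/
structure WeakAction where
  /-- the bilinear map `(h, a) ↦ h a` -/
  act : H →ₗ[R] A →ₗ[R] A
  map_mul' : ∀ a b : A, toConv (act.flip (a * b)) = toConv (act.flip a) * toConv (act.flip b)
  map_one' : toConv (act.flip 1) = (1 : WithConv (H →ₗ[R] A))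
  one_act : ∀ a : A, act 1 a = a

variable {R H A}

/-- The linear map `h ⊗ k ↦ ∑ σ(h₁ ⊗ k₁) ⊗ h₂ k₂`. -/
def cocycleMap (σ : H ⊗[R] H →ₗ[R] A) : H ⊗[R] H →ₗ[R] A ⊗[R] H :=
  TensorProduct.map σ (LinearMap.mul' R H) ∘ₗ comul

/-- For fixed `a`, `a'`, `k`, the linear map `x ⊗ y ↦ ∑ a (x a') σ(y₁ ⊗ k₁) ⊗ y₂ k₂`. -/
def crossedAux (α : WeakAction R H A) (σ : H ⊗[R] H →ₗ[R] A) :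
    A →ₗ[R] A →ₗ[R] H →ₗ[R] H ⊗[R] H →ₗ[R] A ⊗[R] H :=
  LinearMap.mk₂ R
    (fun a a' =>
      { toFun := fun k =>
          TensorProduct.lift
            ((LinearMap.mul R (A ⊗[R] H)).compl₁₂
              ((Algebra.TensorProduct.includeLeft (R := R) (S := R) (A := A) (B := H)).toLinearMap
                ∘ₗ LinearMap.mulLeft R a ∘ₗ α.act.flip a')
              (cocycleMap σ ∘ₗ (TensorProduct.mk R H H).flip k))
        map_add' := fun k k' => by ext x y; simp [mul_add]
        map_smul' := fun r k => by ext x y; simp })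
    (fun a b a' => by ext k x y; simp [add_mul, TensorProduct.add_tmul])
    (fun r a a' => by ext k x y; simp)
    (fun a a' b => by ext k x y; simp [mul_add, TensorProduct.add_tmul])
    (fun r a a' => by ext k x y; simp)

/-- The multiplication of `A #_σ H`, as a bilinear map on `A ⊗ H`:
`(a # h) (a' # k) = ∑ a (h₁ a') σ(h₂ ⊗ k₁) # h₃ k₂`, see `crossedMul_tmul_repr`. -/
def crossedMul (α : WeakAction R H A) (σ : H ⊗[R] H →ₗ[R] A) :
    A ⊗[R] H →ₗ[R] A ⊗[R] H →ₗ[R] A ⊗[R] H :=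
  TensorProduct.lift <| LinearMap.mk₂ R
    (fun a h => TensorProduct.lift <| LinearMap.mk₂ R
      (fun a' k => crossedAux α σ a a' k (comul h))
      (fun _ _ _ => by simp) (fun _ _ _ => by simp) (fun _ _ _ => by simp) (fun _ _ _ => by simp))
    (fun _ _ _ => by ext; simp) (fun _ _ _ => by ext; simp)
    (fun _ _ _ => by ext; simp) (fun _ _ _ => by ext; simp)

lemma cocycleMap_tmul_repr (σ : H ⊗[R] H →ₗ[R] A) {h k : H} {ι κ : Type*} (𝓗 : Coalgebra.Repr R h ι)
    (𝓚 : Coalgebra.Repr R k κ) :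
    cocycleMap σ (h ⊗ₜ k) = ∑ i ∈ 𝓗.index, ∑ j ∈ 𝓚.index,
      σ (𝓗.left i ⊗ₜ 𝓚.left j) ⊗ₜ[R] (𝓗.right i * 𝓚.right j) := by
  rw [Finset.sum_comm]
  simp [cocycleMap, ← 𝓗.eq, ← 𝓚.eq, TensorProduct.sum_tmul, TensorProduct.tmul_sum]

lemma crossedMul_tmul (α : WeakAction R H A) (σ : H ⊗[R] H →ₗ[R] A) (a a' : A) (h k : H) :
    crossedMul α σ (a ⊗ₜ h) (a' ⊗ₜ k) = crossedAux α σ a a' k (comul h) := by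
  simp [crossedMul]

lemma crossedAux_tmul (α : WeakAction R H A) (σ : H ⊗[R] H →ₗ[R] A) (a a' : A) (k x y : H) :
    crossedAux α σ a a' k (x ⊗ₜ y) = ((a * α.act x a') ⊗ₜ 1) * cocycleMap σ (y ⊗ₜ k) := by
  simp [crossedAux]

/-- The multiplication in Sweedler notation. -/
lemma crossedMul_tmul_repr (α : WeakAction R H A) (σ : H ⊗[R] H →ₗ[R] A) (a a' : A) {h k : H}
    {ι κ θ : Type*} (𝓗 : Coalgebra.Repr R h ι) (𝓗' : ∀ i, Coalgebra.Repr R (𝓗.right i) κ)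
    (𝓚 : Coalgebra.Repr R k θ) :
    crossedMul α σ (a ⊗ₜ h) (a' ⊗ₜ k) =
      ∑ i ∈ 𝓗.index, ∑ j ∈ (𝓗' i).index, ∑ l ∈ 𝓚.index,
        (a * α.act (𝓗.left i) a' * σ ((𝓗' i).left j ⊗ₜ 𝓚.left l)) ⊗ₜ[R]
          ((𝓗' i).right j * 𝓚.right l) := by
  rw [crossedMul_tmul, ← 𝓗.eq, map_sum]
  refine Finset.sum_congr rfl fun i _ => ?_
  rw [crossedAux_tmul, cocycleMap_tmul_repr σ (𝓗' i) 𝓚]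
  simp [Finset.mul_sum]

/-- The underlying `R`-module `A ⊗ H` of `A #_σ H`. -/
def CrossedProduct (_α : WeakAction R H A) (_σ : H ⊗[R] H →ₗ[R] A) : Type _ := A ⊗[R] H

namespace CrossedProduct

variable (α : WeakAction R H A) (σ : H ⊗[R] H →ₗ[R] A)

instance : AddCommGroup (CrossedProduct α σ) := inferInstanceAs (AddCommGroup (A ⊗[R] H))

instance : Module R (CrossedProduct α σ) := inferInstanceAs (Module R (A ⊗[R] H))

/-- The identity map from `A ⊗ H` to `A #_σ H`. -/
def ofTensor : A ⊗[R] H ≃ₗ[R] CrossedProduct α σ := LinearEquiv.refl R _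

instance : Mul (CrossedProduct α σ) where
  mul x y := ofTensor α σ
    (crossedMul α σ ((ofTensor α σ).symm x) ((ofTensor α σ).symm y))

/-- The element `1 # 1`. -/
instance : One (CrossedProduct α σ) where
  one := ofTensor α σ (1 ⊗ₜ 1)

lemma mul_def (x y : CrossedProduct α σ) : x * y = ofTensor α σ
    (crossedMul α σ ((ofTensor α σ).symm x) ((ofTensor α σ).symm y)) := rfl

lemma one_def : (1 : CrossedProduct α σ) = ofTensor α σ (1 ⊗ₜ 1) := rfl

end CrossedProduct

/-- `A #_σ H` is a (right `H`-)crossed product: its multiplication is associative, with unity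
`1 # 1`. -/
class IsCrossedProduct (α : WeakAction R H A) (σ : H ⊗[R] H →ₗ[R] A) : Prop where
  mul_assoc : ∀ x y z : CrossedProduct α σ, x * y * z = x * (y * z)
  one_mul : ∀ x : CrossedProduct α σ, 1 * x = x
  mul_one : ∀ x : CrossedProduct α σ, x * 1 = x

namespace CrossedProduct

variable (α : WeakAction R H A) (σ : H ⊗[R] H →ₗ[R] A) [IsCrossedProduct α σ]

instance : Ring (CrossedProduct α σ) where
  __ := (inferInstance : AddCommGroup (CrossedProduct α σ))
  mul_assoc := IsCrossedProduct.mul_assoc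
  one_mul := IsCrossedProduct.one_mul
  mul_one := IsCrossedProduct.mul_one
  left_distrib x y z := by simp [mul_def]
  right_distrib x y z := by simp [mul_def]
  zero_mul x := by simp [mul_def]
  mul_zero x := by simp [mul_def]

instance : Algebra R (CrossedProduct α σ) :=
  Algebra.ofModule (fun r x y => by simp [mul_def]) (fun r x y => by simp [mul_def])

end CrossedProduct

end CrossedProducts

section SmashProducts

variable (R H B : Type*) [CommRing R] [Ring H] [Bialgebra R H] [Ring B] [Algebra R B]

/-- A right `H`-comodule algebra: an `R`-algebra `B` with a coassociative, counital coaction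
`B → B ⊗ H` which is a morphism of `R`-algebras. -/
class ComoduleAlgebra where
  /-- the coaction `b ↦ ∑ b₀ ⊗ b₁` -/
  coaction : B →ₐ[R] B ⊗[R] H
  coassoc : ∀ b : B, TensorProduct.assoc R B H H (coaction.toLinearMap.rTensor H (coaction b)) =
    comul.lTensor B (coaction b)
  counit : ∀ b : B, (counit (R := R) (A := H)).lTensor B (coaction b) = b ⊗ₜ 1

/-- The convolution product of `H^*`, `(f ⋆ g)(h) = ∑ f(h₁) g(h₂)`, as a bilinear map. -/
def dualConv : (H →ₗ[R] R) →ₗ[R] (H →ₗ[R] R) →ₗ[R] (H →ₗ[R] R) :=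
  LinearMap.mk₂ R (fun f g => (toConv f * toConv g).ofConv)
    (fun _ _ _ => by rw [toConv_add, add_mul, ofConv_add])
    (fun _ _ _ => by rw [toConv_smul, smul_mul_assoc, ofConv_smul])
    (fun _ _ _ => by rw [toConv_add, mul_add, ofConv_add])
    (fun _ _ _ => by rw [toConv_smul, mul_smul_comm, ofConv_smul])

/-- The right regular action of `H` on `H^*`: `(f h)(k) = f(h k)`. -/
def dualAct : (H →ₗ[R] R) →ₗ[R] H →ₗ[R] (H →ₗ[R] R) :=
  LinearMap.mk₂ R (fun f h => f ∘ₗ LinearMap.mulLeft R h)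
    (fun _ _ _ => by ext; simp) (fun _ _ _ => by ext; simp)
    (fun _ _ _ => by ext; simp [add_mul]) (fun _ _ _ => by ext; simp)

variable {R H} in
lemma dualConv_def (f g : H →ₗ[R] R) : dualConv R H f g = (toConv f * toConv g).ofConv := rfl

variable {R H} in
@[simp] lemma dualAct_apply (f : H →ₗ[R] R) (h k : H) : dualAct R H f h k = f (h * k) := rfl

variable {R H} in
lemma dualConv_assoc (f g k : H →ₗ[R] R) :
    dualConv R H (dualConv R H f g) k = dualConv R H f (dualConv R H g k) :=
  congrArg ofConv (mul_assoc (toConv f) (toConv g) (toConv k))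

variable {R H} in
lemma counit_dualConv (f : H →ₗ[R] R) : dualConv R H counit f = f :=
  congrArg ofConv (one_mul (toConv f))

variable {R H} in
lemma dualConv_counit (f : H →ₗ[R] R) : dualConv R H f counit = f :=
  congrArg ofConv (mul_one (toConv f))

/-- The underlying `R`-module `B ⊗ H^*` of the smash product `B # H^*`. -/
def SmashProduct : Type _ := B ⊗[R] (H →ₗ[R] R)

instance : AddCommGroup (SmashProduct R H B) :=
  inferInstanceAs (AddCommGroup (B ⊗[R] (H →ₗ[R] R)))

instance : Module R (SmashProduct R H B) :=
  inferInstanceAs (Module R (B ⊗[R] (H →ₗ[R] R)))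

/-- The identity map from `B ⊗ H^*` to `B # H^*`. -/
def SmashProduct.ofTensor : B ⊗[R] (H →ₗ[R] R) ≃ₗ[R] SmashProduct R H B := LinearEquiv.refl R _

variable {R H B}

/-- The unity `1 # ε`. -/
instance : One (SmashProduct R H B) where
  one := SmashProduct.ofTensor R H B (1 ⊗ₜ counit)

lemma SmashProduct.one_def : (1 : SmashProduct R H B) = SmashProduct.ofTensor R H B (1 ⊗ₜ counit) := rfl

lemma dualAct_mul (f : H →ₗ[R] R) (h k : H) :
    dualAct R H f (h * k) = dualAct R H (dualAct R H f h) k := by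
  ext l; simp [mul_assoc]

lemma dualAct_one (f : H →ₗ[R] R) : dualAct R H f 1 = f := by
  ext l; simp

lemma dualAct_counit (h : H) : dualAct R H counit h = counit (R := R) h • counit := by
  ext l; simp

lemma dualAct_dualConv (f g : H →ₗ[R] R) (h : H) :
    dualAct R H (dualConv R H f g) h =
      TensorProduct.lift ((dualConv R H).compl₁₂ (dualAct R H f) (dualAct R H g)) (comul h) := by
  ext k
  let 𝓗 := ℛ R h
  let 𝓚 := ℛ R k
  rw [dualAct_apply, dualConv_def, LinearMap.convMul_apply, Bialgebra.comul_mul,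
    ← 𝓗.eq, ← 𝓚.eq]
  simp only [map_sum, LinearMap.sum_apply, TensorProduct.lift.tmul, LinearMap.compl₁₂_apply,
    Finset.sum_mul_sum, Algebra.TensorProduct.tmul_mul_tmul, TensorProduct.map_tmul,
    LinearMap.mul'_apply]
  refine Finset.sum_congr rfl fun i _ => ?_
  rw [dualConv_def, LinearMap.convMul_apply, ← 𝓚.eq]
  simp

/-- An auxiliary map for the associativity of `B # H^*`:
`c ⊗ g ⊗ g' ↦ b c ⊗ (f g) ⋆ (f' g') ⋆ f''`. -/
def smashAux (b : B) (f f' f'' : H →ₗ[R] R) : B ⊗[R] (H ⊗[R] H) →ₗ[R] B ⊗[R] (H →ₗ[R] R) :=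
  TensorProduct.map (LinearMap.mul R B b) ((dualConv R H).flip f'' ∘ₗ
    TensorProduct.lift ((dualConv R H).compl₁₂ (dualAct R H f) (dualAct R H f')))

lemma smashAux_assoc (b x : B) (y g : H) (f f' f'' : H →ₗ[R] R) (w : B ⊗[R] H) :
    TensorProduct.map (LinearMap.mul R B b)
        ((dualConv R H).flip (dualConv R H (dualAct R H f' g) f''))
        ((dualAct R H f).lTensor B ((x ⊗ₜ y) * w)) =
      smashAux (b * x) (dualAct R H f y) f' f'' (TensorProduct.assoc R B H H (w ⊗ₜ g)) := by
  induction w with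
  | zero => simp
  | add u v hu hv => simp only [map_add, mul_add, TensorProduct.add_tmul, hu, hv]
  | tmul p q => simp [smashAux, dualAct_mul, dualConv_assoc, mul_assoc]

variable (R H B)

variable [ComoduleAlgebra R H B]

/-- The bilinear map `(f, b) ↦ ∑ b₀ ⊗ (f b₁)`. -/
def smashTwist : (H →ₗ[R] R) →ₗ[R] B →ₗ[R] B ⊗[R] (H →ₗ[R] R) :=
  LinearMap.mk₂ R
    (fun f b => (dualAct R H f).lTensor B (ComoduleAlgebra.coaction (R := R) (H := H) b))
    (fun _ _ _ => by simp [LinearMap.lTensor_add]) (fun _ _ _ => by simp [LinearMap.lTensor_smul])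
    (fun _ _ _ => by simp) (fun _ _ _ => by simp)

/-- The multiplication of `B # H^*`, as a bilinear map on `B ⊗ H^*`:
`(b # f) (b' # f') = ∑ b b'₀ # (f b'₁) ⋆ f'`, with `⋆` the convolution product of `H^*`;
see `smashMul_tmul_sum`. -/
def smashMul : B ⊗[R] (H →ₗ[R] R) →ₗ[R] B ⊗[R] (H →ₗ[R] R) →ₗ[R] B ⊗[R] (H →ₗ[R] R) :=
  TensorProduct.lift <| LinearMap.mk₂ R
    (fun b f => TensorProduct.lift <| LinearMap.mk₂ R
      (fun b' f' => TensorProduct.map (LinearMap.mul R B b) ((dualConv R H).flip f')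
        (smashTwist R H B f b'))
      (fun _ _ _ => by simp) (fun _ _ _ => by simp)
      (fun _ _ _ => by simp [TensorProduct.map_add_right])
      (fun _ _ _ => by simp [TensorProduct.map_smul_right]))
    (fun _ _ _ => by ext1; ext1; ext1; simp [TensorProduct.map_add_left])
    (fun _ _ _ => by ext1; ext1; ext1; simp [TensorProduct.map_smul_left])
    (fun _ _ _ => by ext1; ext1; ext1; simp)
    (fun _ _ _ => by ext1; ext1; ext1; simp)

variable {R H B}

lemma smashMul_tmul (b b' : B) (f f' : H →ₗ[R] R) :
    smashMul R H B (b ⊗ₜ f) (b' ⊗ₜ f') =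
      TensorProduct.map (LinearMap.mul R B b) ((dualConv R H).flip f')
        (smashTwist R H B f b') := by
  simp [smashMul]

lemma smashTwist_apply (b : B) (f : H →ₗ[R] R) :
    smashTwist R H B f b =
      (dualAct R H f).lTensor B (ComoduleAlgebra.coaction (R := R) (H := H) b) := rfl

/-- The multiplication of `B # H^*` in Sweedler notation. -/
lemma smashMul_tmul_sum (b b' : B) (f f' : H →ₗ[R] R) {ι : Type*} (s : Finset ι)
    (x : ι → B) (y : ι → H)
    (hb : ComoduleAlgebra.coaction (R := R) (H := H) b' = ∑ i ∈ s, x i ⊗ₜ y i) :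
    smashMul R H B (b ⊗ₜ f) (b' ⊗ₜ f') =
      ∑ i ∈ s, (b * x i) ⊗ₜ dualConv R H (dualAct R H f (y i)) f' := by
  simp [smashMul_tmul, smashTwist_apply, hb]

lemma smashMul_tmul_eq_aux (b c : B) (f f' f'' : H →ₗ[R] R) :
    smashMul R H B (b ⊗ₜ dualConv R H f f') (c ⊗ₜ f'') =
      smashAux b f f' f''
        (comul.lTensor B (ComoduleAlgebra.coaction (R := R) (H := H) c)) := by
  rw [smashMul_tmul, smashTwist_apply, smashAux]
  induction ComoduleAlgebra.coaction (R := R) (H := H) c with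
  | zero => simp
  | add u v hu hv => simp only [map_add, hu, hv]
  | tmul p q => simp [dualAct_dualConv]

lemma smashMul_assoc (u v w : B ⊗[R] (H →ₗ[R] R)) :
    smashMul R H B (smashMul R H B u v) w = smashMul R H B u (smashMul R H B v w) := by
  induction u with
  | zero => simp
  | add u u' h h' => simp only [map_add, LinearMap.add_apply, h, h']
  | tmul b f =>
  induction v with
  | zero => simp
  | add u u' h h' => simp only [map_add, LinearMap.add_apply, h, h']
  | tmul b' f' =>
  induction w with
  | zero => simp
  | add u u' h h' => simp only [map_add, h, h']
  | tmul b'' f'' =>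
  obtain ⟨m, x, y, hxy⟩ := TensorProduct.exists_sum_tmul_eq
    (ComoduleAlgebra.coaction (R := R) (H := H) b')
  obtain ⟨n, c, g, hcg⟩ := TensorProduct.exists_sum_tmul_eq
    (ComoduleAlgebra.coaction (R := R) (H := H) b'')
  rw [smashMul_tmul_sum b b' f f' _ x y hxy, smashMul_tmul_sum b' b'' f' f'' _ c g hcg]
  simp only [map_sum, LinearMap.sum_apply]
  have hR : ∀ j, smashMul R H B (b ⊗ₜ f) ((b' * c j) ⊗ₜ dualConv R H (dualAct R H f' (g j)) f'') =
      ∑ i, smashAux (b * x i) (dualAct R H f (y i)) f' f''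
        (TensorProduct.assoc R B H H
          (ComoduleAlgebra.coaction (R := R) (H := H) (c j) ⊗ₜ g j)) := by
    intro j
    rw [smashMul_tmul, smashTwist_apply, map_mul, hxy, Finset.sum_mul]
    simp only [map_sum]
    exact Finset.sum_congr rfl fun i _ => smashAux_assoc b (x i) (y i) (g j) f f' f'' _
  simp only [hR, smashMul_tmul_eq_aux]
  rw [Finset.sum_comm]
  refine Finset.sum_congr rfl fun i _ => ?_
  rw [← ComoduleAlgebra.coassoc, hcg]
  simp

lemma one_smashMul (u : B ⊗[R] (H →ₗ[R] R)) :
    smashMul R H B (1 ⊗ₜ counit) u = u := by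
  induction u with
  | zero => simp
  | add u v hu hv => simp only [map_add, hu, hv]
  | tmul b f =>
    have h := ComoduleAlgebra.counit (R := R) (H := H) b
    rw [smashMul_tmul, smashTwist_apply]
    have key : ∀ w : B ⊗[R] H, TensorProduct.map (LinearMap.mul R B 1) ((dualConv R H).flip f)
        ((dualAct R H counit).lTensor B w) =
        (LinearMap.toSpanSingleton R _ f).lTensor B
          ((counit (R := R) (A := H)).lTensor B w) := by
      intro w
      induction w with
      | zero => simp
      | add u v hu hv => simp only [map_add, hu, hv]
      | tmul p q => simp [dualAct_counit, counit_dualConv]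
    rw [key, h]
    simp

lemma smashMul_one (u : B ⊗[R] (H →ₗ[R] R)) :
    smashMul R H B u (1 ⊗ₜ counit) = u := by
  induction u with
  | zero => simp
  | add u v hu hv => simp only [map_add, LinearMap.add_apply, hu, hv]
  | tmul b f =>
    rw [smashMul_tmul, smashTwist_apply, map_one, Algebra.TensorProduct.one_def]
    simp [dualAct_one, dualConv_counit]

namespace SmashProduct

instance : Mul (SmashProduct R H B) where
  mul x y := ofTensor R H B
    (smashMul R H B ((ofTensor R H B).symm x) ((ofTensor R H B).symm y))

lemma mul_def (x y : SmashProduct R H B) : x * y = ofTensor R H B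
    (smashMul R H B ((ofTensor R H B).symm x) ((ofTensor R H B).symm y)) := rfl

instance : Ring (SmashProduct R H B) where
  __ := (inferInstance : AddCommGroup (SmashProduct R H B))
  mul_assoc x y z := by simp [mul_def, smashMul_assoc]
  one_mul x := by simp [mul_def, one_def, one_smashMul]
  mul_one x := by simp [mul_def, one_def, smashMul_one]
  left_distrib x y z := by simp [mul_def]
  right_distrib x y z := by simp [mul_def]
  zero_mul x := by simp [mul_def]
  mul_zero x := by simp [mul_def]

instance : Algebra R (SmashProduct R H B) :=
  Algebra.ofModule (fun r x y => by simp [mul_def]) (fun r x y => by simp [mul_def])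

end SmashProduct

end SmashProducts

section CrossedCoaction

variable {R H A : Type*} [CommRing R] [Ring H] [Bialgebra R H] [Ring A] [Algebra R A]

variable (R H A) in
/-- The coaction `id ⊗ Δ : A ⊗ H → (A ⊗ H) ⊗ H`, as a morphism of tensor product algebras. -/
def tensorCoaction : A ⊗[R] H →ₐ[R] (A ⊗[R] H) ⊗[R] H :=
  (Algebra.TensorProduct.assoc R R R A H H).symm.toAlgHom.comp
    (Algebra.TensorProduct.map (AlgHom.id R A) (Bialgebra.comulAlgHom R H))

lemma tensorCoaction_tmul (a : A) (h : H) :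
    tensorCoaction R H A (a ⊗ₜ h) = (TensorProduct.assoc R A H H).symm (a ⊗ₜ comul h) := rfl

lemma tensorCoaction_toLinearMap : (tensorCoaction R H A).toLinearMap =
    (TensorProduct.assoc R A H H).symm.toLinearMap ∘ₗ comul.lTensor A := by
  ext a h; rfl

lemma tensorCoaction_cocycleMap (σ : H ⊗[R] H →ₗ[R] A) (z : H ⊗[R] H) :
    tensorCoaction R H A (cocycleMap σ z) =
      TensorProduct.map (cocycleMap σ) (LinearMap.mul' R H) (comul z) := by
  have hmul : ∀ w : H ⊗[R] H, comul (R := R) (LinearMap.mul' R H w) =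
      TensorProduct.map (LinearMap.mul' R H) (LinearMap.mul' R H) (comul w) := by
    intro w
    induction w with
    | zero => simp
    | add u v hu hv => simp only [map_add, hu, hv]
    | tmul x y =>
      rw [LinearMap.mul'_apply, Bialgebra.comul_mul, TensorProduct.comul_tmul]
      simp only [← (ℛ R x).eq, ← (ℛ R y).eq]
      simp [TensorProduct.sum_tmul, TensorProduct.tmul_sum, Finset.sum_mul_sum]
      rw [Finset.sum_comm]
  have h1 : ∀ w : (H ⊗[R] H) ⊗[R] (H ⊗[R] H),
      tensorCoaction R H A (TensorProduct.map σ (LinearMap.mul' R H) w) =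
      TensorProduct.map (TensorProduct.map σ (LinearMap.mul' R H)) (LinearMap.mul' R H)
        ((TensorProduct.assoc R _ _ _).symm (comul.lTensor (H ⊗[R] H) w)) := by
    intro w
    induction w with
    | zero => simp
    | add u v hu hv => simp only [map_add, hu, hv]
    | tmul x y =>
      rw [TensorProduct.map_tmul, tensorCoaction_tmul, hmul, LinearMap.lTensor_tmul]
      generalize comul (R := R) y = t
      induction t with
      | zero => simp
      | add u v hu hv => simp only [map_add, TensorProduct.tmul_add, hu, hv]
      | tmul p q => simp
  have h2 : ∀ w : (H ⊗[R] H) ⊗[R] (H ⊗[R] H),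
      TensorProduct.map (cocycleMap σ) (LinearMap.mul' R H) w =
      TensorProduct.map (TensorProduct.map σ (LinearMap.mul' R H)) (LinearMap.mul' R H)
        (comul.rTensor (H ⊗[R] H) w) := by
    intro w
    induction w with
    | zero => simp
    | add u v hu hv => simp only [map_add, hu, hv]
    | tmul x y => simp [cocycleMap]
  rw [h2, ← Coalgebra.coassoc_symm_apply, ← h1]
  rfl

lemma tensorCoaction_crossedAux (α : WeakAction R H A) (σ : H ⊗[R] H →ₗ[R] A) (a a' : A)
    {k : H} {κ : Type*} (𝓚 : Coalgebra.Repr R k κ) (w : H ⊗[R] H) :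
    tensorCoaction R H A (crossedAux α σ a a' k w) =
      ∑ l ∈ 𝓚.index, TensorProduct.map (crossedAux α σ a a' (𝓚.left l))
        (LinearMap.mulRight R (𝓚.right l))
        ((TensorProduct.assoc R H H H).symm (comul.lTensor H w)) := by
  induction w with
  | zero => simp
  | add u v hu hv => simp only [map_add, hu, hv, Finset.sum_add_distrib]
  | tmul x y =>
    have h1 : tensorCoaction R H A ((a * α.act x a') ⊗ₜ 1) =
        ((a * α.act x a') ⊗ₜ 1) ⊗ₜ 1 := by
      rw [tensorCoaction_tmul, Bialgebra.comul_one, Algebra.TensorProduct.one_def]; rfl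
    rw [crossedAux_tmul, map_mul, h1, tensorCoaction_cocycleMap, TensorProduct.comul_tmul,
      LinearMap.lTensor_tmul]
    simp only [← (ℛ R y).eq, ← 𝓚.eq]
    simp [TensorProduct.sum_tmul, TensorProduct.tmul_sum, Finset.mul_sum, crossedAux_tmul]

variable (α : WeakAction R H A) (σ : H ⊗[R] H →ₗ[R] A)

/-- The coaction `id ⊗ Δ` of `H` on `A #_σ H`, as a linear map. -/
def crossedCoaction : CrossedProduct α σ →ₗ[R] CrossedProduct α σ ⊗[R] H :=
  (CrossedProduct.ofTensor α σ).toLinearMap.rTensor H ∘ₗ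
    (TensorProduct.assoc R A H H).symm.toLinearMap ∘ₗ
    (comul (R := R) (A := H)).lTensor A ∘ₗ
    (CrossedProduct.ofTensor α σ).symm.toLinearMap

lemma crossedCoaction_apply (z : A ⊗[R] H) :
    crossedCoaction α σ (CrossedProduct.ofTensor α σ z) =
      (CrossedProduct.ofTensor α σ).toLinearMap.rTensor H (tensorCoaction R H A z) := by
  rw [← AlgHom.toLinearMap_apply, tensorCoaction_toLinearMap]
  simp [crossedCoaction]

lemma crossedCoaction_tmul (a : A) {h : H} {ι : Type*} (𝓗 : Coalgebra.Repr R h ι) :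
    crossedCoaction α σ (CrossedProduct.ofTensor α σ (a ⊗ₜ h)) =
      ∑ i ∈ 𝓗.index, CrossedProduct.ofTensor α σ (a ⊗ₜ 𝓗.left i) ⊗ₜ 𝓗.right i := by
  simp [crossedCoaction, ← 𝓗.eq, TensorProduct.tmul_sum]

lemma crossedCoaction_mul [IsCrossedProduct α σ] (x y : CrossedProduct α σ) :
    crossedCoaction α σ (x * y) = crossedCoaction α σ x * crossedCoaction α σ y := by
  obtain ⟨u, rfl⟩ := (CrossedProduct.ofTensor α σ).surjective x
  obtain ⟨v, rfl⟩ := (CrossedProduct.ofTensor α σ).surjective y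
  induction u with
  | zero => simp
  | add u u' h h' => simp only [map_add, add_mul, h, h']
  | tmul a h =>
  induction v with
  | zero => simp
  | add u u' h h' => simp only [map_add, mul_add, h, h']
  | tmul a' k =>
  rw [CrossedProduct.mul_def, crossedCoaction_apply, LinearEquiv.symm_apply_apply,
    LinearEquiv.symm_apply_apply, crossedMul_tmul, tensorCoaction_crossedAux α σ a a' (ℛ R k),
    Coalgebra.coassoc_symm_apply, crossedCoaction_tmul α σ a (ℛ R h),
    crossedCoaction_tmul α σ a' (ℛ R k), Finset.sum_mul_sum, Finset.sum_comm, map_sum]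
  refine Finset.sum_congr rfl fun l _ => ?_
  conv_lhs => rw [← (ℛ R h).eq]
  simp [CrossedProduct.mul_def, crossedMul_tmul]

/-- A crossed product `A #_σ H` is a right `H`-comodule algebra with coaction `id ⊗ Δ`. -/
instance [IsCrossedProduct α σ] : ComoduleAlgebra R H (CrossedProduct α σ) where
  coaction := AlgHom.ofLinearMap (crossedCoaction α σ)
    (by rw [CrossedProduct.one_def, crossedCoaction_apply,
          ← Algebra.TensorProduct.one_def, map_one]; rfl)
    (crossedCoaction_mul α σ)
  coassoc b := by
    obtain ⟨u, rfl⟩ := (CrossedProduct.ofTensor α σ).surjective b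
    rw [AlgHom.toLinearMap_ofLinearMap, AlgHom.ofLinearMap_apply]
    induction u with
    | zero => simp
    | add u v hu hv => simp only [map_add, hu, hv]
    | tmul a h =>
      have hl : ∀ t : H ⊗[R] H,
          TensorProduct.assoc R (CrossedProduct α σ) H H ((crossedCoaction α σ).rTensor H
            ((CrossedProduct.ofTensor α σ).toLinearMap.rTensor H
              ((TensorProduct.assoc R A H H).symm (a ⊗ₜ t)))) =
          (CrossedProduct.ofTensor α σ ∘ₗ TensorProduct.mk R A H a).rTensor (H ⊗[R] H)
            (TensorProduct.assoc R H H H (comul.rTensor H t)) := by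
        intro t
        induction t with
        | zero => simp
        | add u v hu hv => simp only [map_add, TensorProduct.tmul_add, hu, hv]
        | tmul p q =>
          simp only [TensorProduct.assoc_symm_tmul, LinearMap.rTensor_tmul,
            LinearEquiv.coe_coe, crossedCoaction_tmul α σ a (ℛ R p)]
          conv_rhs => rw [← (ℛ R p).eq]
          simp [TensorProduct.sum_tmul]
      have hr : ∀ t : H ⊗[R] H, (comul (R := R) (A := H)).lTensor (CrossedProduct α σ)
          ((CrossedProduct.ofTensor α σ).toLinearMap.rTensor H
            ((TensorProduct.assoc R A H H).symm (a ⊗ₜ t))) =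
          (CrossedProduct.ofTensor α σ ∘ₗ TensorProduct.mk R A H a).rTensor (H ⊗[R] H)
            (comul.lTensor H t) := by
        intro t
        induction t with
        | zero => simp
        | add u v hu hv => simp only [map_add, TensorProduct.tmul_add, hu, hv]
        | tmul p q => simp
      rw [crossedCoaction_apply, tensorCoaction_tmul, hl, hr, Coalgebra.coassoc_apply]
  counit b := by
    obtain ⟨u, rfl⟩ := (CrossedProduct.ofTensor α σ).surjective b
    rw [AlgHom.ofLinearMap_apply]
    induction u with
    | zero => simp
    | add u v hu hv => simp only [map_add, TensorProduct.add_tmul, hu, hv]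
    | tmul a h =>
      have key : ∀ t : H ⊗[R] H, (counit (R := R) (A := H)).lTensor (CrossedProduct α σ)
          ((CrossedProduct.ofTensor α σ).toLinearMap.rTensor H
            ((TensorProduct.assoc R A H H).symm (a ⊗ₜ t))) =
          (CrossedProduct.ofTensor α σ ∘ₗ TensorProduct.mk R A H a).rTensor R
            ((counit (R := R) (A := H)).lTensor H t) := by
        intro t
        induction t with
        | zero => simp
        | add u v hu hv => simp only [map_add, TensorProduct.tmul_add, hu, hv]
        | tmul p q => simp
      rw [crossedCoaction_apply, tensorCoaction_tmul, key, Coalgebra.lTensor_counit_comul]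
      simp

end CrossedCoaction

end HopfCrossed

end

/-! Write `B` for `A #_σ H` and `S` for the antipode. The algebra `B # H^*` acts on `B` from the
right by `x · (b # f) = ∑ (x b)₀ f(S⁻¹((x b)₁))`. These maps are left `A`-linear, and `B` is a free
left `A`-module on a basis of `H`, so matrices acting on row vectors give an algebra map to
`M_n(A)`. The proof shows that this map is bijective (`smashEnd_bijective`).

An `A`-linear endomorphism of `B` is determined by its restriction along `γ : h ↦ 1 # h`, which may
be any `R`-linear map `H → B`. Since `γ` is colinear, acting by `z` and restricting along `γ` gives
the convolution product of `γ` with the image of `z` under two bijections: the twist `b ⊗ f ↦ ∑ b₀ ⊗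
f S⁻¹(b₁)`, and the identification of `B ⊗ H^*` with `Hom(H, B)`, which uses that `H` is free of
finite rank (`smashRight_apply_of_colinear`). It remains to see that `γ` is convolution invertible
and that `S` is bijective.

For `γ`: a map `φ : C → A` is convolution invertible exactly when `a ⊗ c ↦ ∑ a φ(c₁) ⊗ c₂` is
bijective (`mulTwist_bijective_iff`). For `γ` this map is, up to rebracketing, the composite of
those for `σ` and for `id_H` (`mulTwist_crossedSection`); these are invertible by hypothesis and by
the antipode. No formula for the inverse of `γ` is needed.

For `S`: the dual `H^*` is a right Hopf module, with action through `S`. Splitting it as in the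
fundamental theorem of Hopf modules yields a left inverse of `S`, and a surjective endomorphism of a
finite module is injective (`antipode_bijective`). -/

noncomputable section

namespace HopfCrossed

open TensorProduct Coalgebra WithConv

/-! ### Convolution invertibility as bijectivity of a twist map. -/

section Twist

variable {R C X : Type*} [CommRing R] [AddCommGroup C] [Module R C] [Coalgebra R C]
  [AddCommGroup X] [Module R X]

/-- The endomorphism `x ⊗ c ↦ ∑ x φ(c₁) ⊗ c₂` of `X ⊗ C` for a linear map `φ` from a coalgebra `C`
to the endomorphisms of `X`, acting on the right. -/
def convTwist (φ : C →ₗ[R] (Module.End R X)ᵐᵒᵖ) : X ⊗[R] C →ₗ[R] X ⊗[R] C :=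
  (TensorProduct.lift ((MulOpposite.opLinearEquiv R).symm.toLinearMap ∘ₗ φ).flip).rTensor C ∘ₗ
    (TensorProduct.assoc R X C C).symm.toLinearMap ∘ₗ (comul (R := R) (A := C)).lTensor X

lemma convTwist_tmul (φ : C →ₗ[R] (Module.End R X)ᵐᵒᵖ) (x : X) (c : C) :
    convTwist φ (x ⊗ₜ c) =
      (((MulOpposite.opLinearEquiv R).symm.toLinearMap ∘ₗ φ).flip x).rTensor C (comul c) := by
  simp only [convTwist, LinearMap.comp_apply, LinearMap.lTensor_tmul]
  induction comul (R := R) c with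
  | zero => simp
  | add u v hu hv => simp only [map_add, TensorProduct.tmul_add, hu, hv]
  | tmul p q => simp

/-- By coassociativity, both sides send `x ⊗ c` to `∑ x φ(c₁) ψ(c₂) ⊗ c₃`. The order is reversed
because `φ` and `ψ` act on the right. -/
lemma convTwist_mul (φ ψ : WithConv (C →ₗ[R] (Module.End R X)ᵐᵒᵖ)) :
    convTwist (φ * ψ).ofConv = convTwist ψ.ofConv ∘ₗ convTwist φ.ofConv := by
  ext x c
  simp only [TensorProduct.AlgebraTensorModule.curry_apply, TensorProduct.curry_apply,
    LinearMap.coe_restrictScalars, LinearMap.comp_apply]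
  let F : C ⊗[R] (C ⊗[R] C) →ₗ[R] X ⊗[R] C :=
    (((MulOpposite.opLinearEquiv R).symm.toLinearMap ∘ₗ
      LinearMap.mul' R (Module.End R X)ᵐᵒᵖ ∘ₗ TensorProduct.map φ.ofConv ψ.ofConv).flip x).rTensor C
      ∘ₗ (TensorProduct.assoc R C C C).symm.toLinearMap
  have h1 : ∀ w : C ⊗[R] C, convTwist ψ.ofConv
      ((((MulOpposite.opLinearEquiv R).symm.toLinearMap ∘ₗ φ.ofConv).flip x).rTensor C w) =
      F (comul.lTensor C w) := by
    intro w
    induction w with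
    | zero => simp
    | add u v hu hv => simp only [map_add, hu, hv]
    | tmul p q =>
      rw [LinearMap.rTensor_tmul, convTwist_tmul, LinearMap.lTensor_tmul]
      induction comul (R := R) q with
      | zero => simp
      | add u v hu hv => simp only [map_add, TensorProduct.tmul_add, hu, hv]
      | tmul a b => simp [F]
  have h2 : ∀ w : C ⊗[R] C,
      (((MulOpposite.opLinearEquiv R).symm.toLinearMap ∘ₗ (φ * ψ).ofConv).flip x).rTensor C w =
      F (TensorProduct.assoc R C C C (comul.rTensor C w)) := by
    intro w
    induction w with
    | zero => simp
    | add u v hu hv => simp only [map_add, hu, hv]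
    | tmul p q =>
      simp only [LinearMap.rTensor_tmul, F, LinearMap.comp_apply, LinearEquiv.coe_coe,
        LinearEquiv.symm_apply_apply]
      rfl
  rw [convTwist_tmul, convTwist_tmul, h1, h2, Coalgebra.coassoc_apply]

lemma convTwist_one :
    convTwist (1 : WithConv (C →ₗ[R] (Module.End R X)ᵐᵒᵖ)).ofConv = LinearMap.id := by
  ext x c
  simp only [TensorProduct.AlgebraTensorModule.curry_apply, TensorProduct.curry_apply,
    LinearMap.coe_restrictScalars, LinearMap.id_apply]
  have h : ∀ w : C ⊗[R] C, (((MulOpposite.opLinearEquiv R).symm.toLinearMap ∘ₗ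
      (1 : WithConv (C →ₗ[R] (Module.End R X)ᵐᵒᵖ)).ofConv).flip x).rTensor C w =
      (LinearMap.toSpanSingleton R X x).rTensor C (counit.rTensor C w) := by
    intro w
    induction w with
    | zero => simp
    | add u v hu hv => simp only [map_add, hu, hv]
    | tmul p q =>
      simp [LinearMap.convOne_def, MulOpposite.algebraMap_apply, Module.algebraMap_end_apply]
  rw [convTwist_tmul, h, Coalgebra.rTensor_counit_comul]
  simp

lemma convTwist_bijective {φ : C →ₗ[R] (Module.End R X)ᵐᵒᵖ} (h : IsUnit (toConv φ)) :
    Function.Bijective (convTwist φ) := by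
  obtain ⟨⟨φ', ψ, h1, h2⟩, rfl⟩ := h
  refine Function.bijective_iff_has_inverse.2 ⟨convTwist ψ.ofConv, fun z => ?_, fun z => ?_⟩
  · have := convTwist_mul (toConv φ) ψ
    rw [h1, convTwist_one] at this
    exact (LinearMap.congr_fun this z).symm
  · have := convTwist_mul ψ (toConv φ)
    rw [h2, convTwist_one] at this
    exact (LinearMap.congr_fun this z).symm

/-- Composition with an algebra map respects convolution products and their unit, hence also
inverses. This transports the invertibility of `id_H` to every algebra map out of `H`. -/
lemma isUnit_toConv_comp {A A' : Type*} [Ring A] [Algebra R A] [Ring A'] [Algebra R A']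
    (g : A →ₐ[R] A') {φ : C →ₗ[R] A} (h : IsUnit (toConv φ)) :
    IsUnit (toConv (g.toLinearMap ∘ₗ φ)) := by
  have h1 : toConv (g.toLinearMap ∘ₗ (1 : WithConv (C →ₗ[R] A)).ofConv) = 1 := by
    ext; simp [LinearMap.convOne_def]
  obtain ⟨⟨φ', ψ, h2, h3⟩, rfl⟩ := h
  refine ⟨⟨_, toConv (g.toLinearMap ∘ₗ ψ.ofConv), ?_, ?_⟩, rfl⟩
  · rw [← h1, ← h2]
    exact congrArg toConv (LinearMap.algHom_comp_convMul_distrib g (toConv φ) ψ).symm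
  · rw [← h1, ← h3]
    exact congrArg toConv (LinearMap.algHom_comp_convMul_distrib g ψ (toConv φ)).symm

/-- The twist by `φ` is colinear. -/
lemma lTensor_comul_convTwist (φ : C →ₗ[R] (Module.End R X)ᵐᵒᵖ) (z : X ⊗[R] C) :
    (comul (R := R) (A := C)).lTensor X (convTwist φ z) =
      TensorProduct.assoc R X C C ((convTwist φ).rTensor C
        ((TensorProduct.assoc R X C C).symm (comul.lTensor X z))) := by
  induction z with
  | zero => simp
  | add u v hu hv => simp only [map_add, hu, hv]
  | tmul x c =>
    let f := ((MulOpposite.opLinearEquiv R).symm.toLinearMap ∘ₗ φ).flip x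
    have h1 : ∀ w : C ⊗[R] C, (comul (R := R) (A := C)).lTensor X (f.rTensor C w) =
        f.rTensor (C ⊗[R] C) (comul.lTensor C w) := by
      intro w
      induction w with
      | zero => simp
      | add u v hu hv => simp only [map_add, hu, hv]
      | tmul p q => simp
    have h2 : ∀ w : C ⊗[R] C, TensorProduct.assoc R X C C ((convTwist φ).rTensor C
        ((TensorProduct.assoc R X C C).symm (x ⊗ₜ w))) =
        f.rTensor (C ⊗[R] C) (TensorProduct.assoc R C C C (comul.rTensor C w)) := by
      intro w
      induction w with
      | zero => simp
      | add u v hu hv => simp only [map_add, TensorProduct.tmul_add, hu, hv]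
      | tmul p q =>
        rw [TensorProduct.assoc_symm_tmul, LinearMap.rTensor_tmul, convTwist_tmul,
          LinearMap.rTensor_tmul]
        change TensorProduct.assoc R X C C (f.rTensor C (comul p) ⊗ₜ q) = _
        induction comul (R := R) p with
        | zero => simp
        | add u v hu hv => simp only [map_add, TensorProduct.add_tmul, hu, hv]
        | tmul a b => simp
    rw [convTwist_tmul, LinearMap.lTensor_tmul, h2, h1, Coalgebra.coassoc_apply]

variable {A : Type*} [Ring A] [Algebra R A]

variable (R A) in
/-- Right multiplication, as a morphism of algebras. -/
def mulRightAlgHom : A →ₐ[R] (Module.End R A)ᵐᵒᵖ :=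
  AlgHom.ofLinearMap ((MulOpposite.opLinearEquiv R).toLinearMap ∘ₗ (LinearMap.mul R A).flip)
    (MulOpposite.unop_injective (by ext; simp))
    (fun _ _ => MulOpposite.unop_injective (by ext; simp [mul_assoc]))

/-- The endomorphism `a ⊗ c ↦ ∑ a φ(c₁) ⊗ c₂` of `A ⊗ C`. -/
def mulTwist (φ : C →ₗ[R] A) : A ⊗[R] C →ₗ[R] A ⊗[R] C :=
  convTwist ((mulRightAlgHom R A).toLinearMap ∘ₗ φ)

lemma mulTwist_tmul (φ : C →ₗ[R] A) (a : A) (c : C) :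
    mulTwist φ (a ⊗ₜ c) = (LinearMap.mulLeft R a ∘ₗ φ).rTensor C (comul c) :=
  convTwist_tmul _ _ _

lemma mulTwist_mul (φ ψ : WithConv (C →ₗ[R] A)) :
    mulTwist (φ * ψ).ofConv = mulTwist ψ.ofConv ∘ₗ mulTwist φ.ofConv := by
  rw [mulTwist, LinearMap.algHom_comp_convMul_distrib, convTwist_mul]; rfl

lemma mulTwist_one : mulTwist (1 : WithConv (C →ₗ[R] A)).ofConv = LinearMap.id := by
  rw [← convTwist_one (R := R) (C := C) (X := A), mulTwist]
  congr 1
  ext; simp [LinearMap.convOne_def]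

lemma rid_counit_mulTwist (φ : C →ₗ[R] A) (c : C) :
    TensorProduct.rid R A ((counit (R := R) (A := C)).lTensor A (mulTwist φ (1 ⊗ₜ c))) = φ c := by
  have h : ∀ w : C ⊗[R] C, TensorProduct.rid R A ((counit (R := R) (A := C)).lTensor A
      ((LinearMap.mulLeft R 1 ∘ₗ φ).rTensor C w)) =
      φ (TensorProduct.rid R C (counit.lTensor C w)) := by
    intro w
    induction w with
    | zero => simp
    | add u v hu hv => simp only [map_add, hu, hv]
    | tmul p q => simp
  rw [mulTwist_tmul, h, Coalgebra.lTensor_counit_comul]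
  simp

/-- Applying the counit to the second leg of the value at `1 ⊗ c` recovers `φ(c)`. -/
lemma mulTwist_injective : Function.Injective (mulTwist : (C →ₗ[R] A) → _) := by
  intro φ ψ h
  ext c
  rw [← rid_counit_mulTwist φ, h, rid_counit_mulTwist]

/-- The twists are left `A`-linear and right `C`-colinear, and any endomorphism of `A ⊗ C` with both
properties is a twist. An inverse of a twist inherits them, so it is the twist by some `θ`, which is
then the convolution inverse. -/
lemma mulTwist_bijective_iff {φ : C →ₗ[R] A} :
    Function.Bijective (mulTwist φ) ↔ IsUnit (toConv φ) := by
  refine ⟨fun h => ?_, fun h => convTwist_bijective (isUnit_toConv_comp _ h)⟩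
  let e := LinearEquiv.ofBijective _ h
  let T : A ⊗[R] C →ₗ[R] A ⊗[R] C := e.symm.toLinearMap
  have hT : T ∘ₗ mulTwist φ = LinearMap.id :=
    LinearMap.ext e.symm_apply_apply
  have hT' : mulTwist φ ∘ₗ T = LinearMap.id :=
    LinearMap.ext e.apply_symm_apply
  have hmul : ∀ (a : A) (z : A ⊗[R] C),
      T ((LinearMap.mulLeft R a).rTensor C z) = (LinearMap.mulLeft R a).rTensor C (T z) := by
    intro a z
    have hT₁ : ∀ z, T (mulTwist φ z) = z := LinearMap.congr_fun hT
    have hT₂ : ∀ z, mulTwist φ (T z) = z := LinearMap.congr_fun hT'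
    apply h.1
    obtain ⟨z, rfl⟩ := h.2 z
    rw [hT₂, hT₁]
    induction z with
    | zero => simp
    | add u v hu hv => simp only [map_add, hu, hv]
    | tmul b c =>
      rw [LinearMap.rTensor_tmul, mulTwist_tmul, mulTwist_tmul, ← LinearMap.comp_apply,
        ← LinearMap.rTensor_comp, ← LinearMap.comp_assoc, LinearMap.mulLeft_apply,
        LinearMap.mulLeft_mul]
  have hco : ∀ z, (comul (R := R) (A := C)).lTensor A (T z) =
      TensorProduct.assoc R A C C (T.rTensor C
        ((TensorProduct.assoc R A C C).symm (comul.lTensor A z))) := by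
    intro z
    obtain ⟨z, rfl⟩ := h.2 z
    have := lTensor_comul_convTwist ((mulRightAlgHom R A).toLinearMap ∘ₗ φ) z
    rw [mulTwist, this, LinearEquiv.symm_apply_apply, ← LinearMap.comp_apply (T.rTensor C),
      ← LinearMap.rTensor_comp]
    change _ = TensorProduct.assoc R A C C ((T ∘ₗ mulTwist φ).rTensor C _)
    change (comul (R := R) (A := C)).lTensor A ((T ∘ₗ mulTwist φ) z) = _
    rw [hT]
    simp
  let E : A ⊗[R] C →ₗ[R] A :=
    (TensorProduct.rid R A).toLinearMap ∘ₗ (counit (R := R) (A := C)).lTensor A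
  -- The cofree property: a colinear map into `A ⊗ C` is recovered from its composite with `E = id ⊗
  -- ε`.
  have hE : ∀ z, E.rTensor C ((TensorProduct.assoc R A C C).symm (comul.lTensor A z)) = z := by
    intro z
    induction z with
    | zero => simp
    | add u v hu hv => simp only [map_add, hu, hv]
    | tmul a c =>
      have h1 : ∀ w : C ⊗[R] C, E.rTensor C ((TensorProduct.assoc R A C C).symm (a ⊗ₜ w)) =
          a ⊗ₜ TensorProduct.lid R C (counit.rTensor C w) := by
        intro w
        induction w with
        | zero => simp
        | add u v hu hv => simp only [map_add, TensorProduct.tmul_add, hu, hv]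
        | tmul p q => simp [E, TensorProduct.smul_tmul]
      rw [LinearMap.lTensor_tmul, h1, Coalgebra.rTensor_counit_comul]
      simp
  have hEmul : ∀ a z, E ((LinearMap.mulLeft R a).rTensor C z) = a * E z := by
    intro a z
    induction z with
    | zero => simp
    | add u v hu hv => simp only [map_add, mul_add, hu, hv]
    | tmul b c => simp [E]
  let θ : C →ₗ[R] A := E ∘ₗ T ∘ₗ TensorProduct.mk R A C 1
  have hθ : mulTwist θ = T := by
    ext a c
    simp only [TensorProduct.AlgebraTensorModule.curry_apply, TensorProduct.curry_apply,
      LinearMap.coe_restrictScalars]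
    have h1 := congrArg (E.rTensor C ∘ (TensorProduct.assoc R A C C).symm) (hco (a ⊗ₜ c))
    simp only [Function.comp_apply, LinearEquiv.symm_apply_apply, hE] at h1
    rw [h1, mulTwist_tmul, LinearMap.lTensor_tmul]
    induction comul (R := R) c with
    | zero => simp
    | add u v hu hv => simp only [map_add, TensorProduct.tmul_add, hu, hv]
    | tmul p q =>
      simp only [LinearMap.rTensor_tmul, TensorProduct.assoc_symm_tmul, LinearMap.comp_apply, θ,
        LinearMap.mulLeft_apply, ← hEmul, ← hmul, TensorProduct.mk_apply, mul_one]
  refine ⟨⟨toConv φ, toConv θ, ?_, ?_⟩, rfl⟩ <;>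
  · apply WithConv.ofConv_injective
    apply mulTwist_injective
    rw [mulTwist_mul, mulTwist_one]
    simp only [hθ, hT, hT']

end Twist

/-! ### The antipode and the comultiplication. -/

section Antipode

variable {R H : Type*} [CommRing R] [Ring H] [HopfAlgebra R H]

lemma isUnit_toConv_id : IsUnit (toConv (LinearMap.id : H →ₗ[R] H)) :=
  ⟨⟨_, toConv (HopfAlgebra.antipode R), LinearMap.id_mul_antipode, LinearMap.antipode_mul_id⟩, rfl⟩

/-- The antipode reverses the comultiplication. -/
lemma comul_antipode (h : H) : comul (R := R) (HopfAlgebra.antipode R h) =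
    TensorProduct.map (HopfAlgebra.antipode R) (HopfAlgebra.antipode R)
      (TensorProduct.comm R H H (comul h)) := by
  let S := HopfAlgebra.antipode R (A := H)
  let i₁ : H →ₐ[R] H ⊗[R] H := Algebra.TensorProduct.includeLeft
  let i₂ : H →ₐ[R] H ⊗[R] H := Algebra.TensorProduct.includeRight
  have key : ∀ (g : H →ₐ[R] H ⊗[R] H),
      toConv (g.toLinearMap ∘ₗ S) * toConv g.toLinearMap = 1 := by
    intro g
    have := LinearMap.algHom_comp_convMul_distrib g (toConv S) (toConv LinearMap.id)
    rw [LinearMap.antipode_mul_id] at this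
    apply WithConv.ofConv_injective
    refine (this.symm.trans ?_)
    ext; simp [LinearMap.convOne_def]
  -- In the convolution algebra `Hom(H, H ⊗ H)`, `Δ` factors as `i₁ * i₂`, so the inverses of the
  -- factors, multiplied in reverse order, form a left inverse of `Δ`. This must agree with the
  -- right inverse `Δ ∘ S`.
  have hδ : toConv (comul (R := R) (A := H)) = toConv i₁.toLinearMap * toConv i₂.toLinearMap := by
    ext h
    simp only [LinearMap.convMul_apply]
    induction comul (R := R) h with
    | zero => simp
    | add u v hu hv => rw [map_add, map_add, ← hu, ← hv]
    | tmul p q => simp [i₁, i₂]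
  have hG : toConv (TensorProduct.map S S ∘ₗ (TensorProduct.comm R H H).toLinearMap ∘ₗ comul) =
      toConv (i₂.toLinearMap ∘ₗ S) * toConv (i₁.toLinearMap ∘ₗ S) := by
    ext h
    simp only [LinearMap.convMul_apply]
    change TensorProduct.map S S (TensorProduct.comm R H H (comul (R := R) h)) = _
    induction comul (R := R) h with
    | zero => simp
    | add u v hu hv => simp only [map_add, hu, hv]
    | tmul p q => simp [i₁, i₂]
  have hl : toConv (TensorProduct.map S S ∘ₗ (TensorProduct.comm R H H).toLinearMap ∘ₗ comul) *
      toConv (comul (R := R) (A := H)) = 1 := by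
    rw [hG, hδ, mul_assoc, ← mul_assoc (toConv (i₁.toLinearMap ∘ₗ S)), key, one_mul, key]
  have := left_inv_eq_right_inv hl LinearMap.comul_right_inv
  exact (LinearMap.congr_fun (congrArg ofConv this) h).symm

end Antipode

/-! ### Right Hopf modules and the twist by the action. -/

section HopfModule

variable {R H M : Type*} [CommRing R] [Ring H] [Bialgebra R H] [AddCommGroup M] [Module R M]

/-- The diagonal right action `(m ⊗ k) h = ∑ m h₁ ⊗ k h₂` of `H` on `M ⊗ H`. -/
def diagAct (act : H →ₐ[R] (Module.End R M)ᵐᵒᵖ) : H →ₐ[R] (Module.End R (M ⊗[R] H))ᵐᵒᵖ :=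
  let f : H ⊗[R] H →ₗ[R] Module.End R (M ⊗[R] H) :=
    TensorProduct.homTensorHomMap (.id R) M H M H ∘ₗ
      TensorProduct.map ((MulOpposite.opLinearEquiv R).symm.toLinearMap ∘ₗ act.toLinearMap)
        (LinearMap.mul R H).flip
  have hf : ∀ u v, f (u * v) = f v ∘ₗ f u := by
    intro u v
    induction u with
    | zero => simp
    | add u u' h h' => simp only [map_add, add_mul, LinearMap.comp_add, h, h']
    | tmul a b =>
    induction v with
    | zero => simp
    | add u u' h h' => simp only [map_add, mul_add, LinearMap.add_comp, h, h']
    | tmul c d => ext m k; simp [f, mul_assoc]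
  AlgHom.ofLinearMap ((MulOpposite.opLinearEquiv R).toLinearMap ∘ₗ f ∘ₗ comul)
    (MulOpposite.unop_injective (by
      ext m k
      simp [f, Bialgebra.comul_one, Algebra.TensorProduct.one_def]))
    (fun u v => MulOpposite.unop_injective (by simp [hf, Module.End.mul_eq_comp]))

lemma diagAct_tmul (act : H →ₐ[R] (Module.End R M)ᵐᵒᵖ) (m : M) (k h : H) :
    (diagAct act h).unop (m ⊗ₜ k) =
      TensorProduct.map (((MulOpposite.opLinearEquiv R).symm.toLinearMap ∘ₗ act.toLinearMap).flip m)
        (LinearMap.mulLeft R k) (comul h) := by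
  change TensorProduct.homTensorHomMap (.id R) M H M H (TensorProduct.map _ _ (comul h)) (m ⊗ₜ k) = _
  induction comul (R := R) h with
  | zero => simp
  | add u v hu hv => simp only [map_add, LinearMap.add_apply, hu, hv]
  | tmul p q => simp

/-- The data of a right Hopf module. -/
structure HopfModuleData (R H M : Type*) [CommRing R] [Ring H] [Bialgebra R H] [AddCommGroup M]
    [Module R M] where
  act : H →ₐ[R] (Module.End R M)ᵐᵒᵖ
  coact : M →ₗ[R] M ⊗[R] H
  coassoc : ∀ m : M, TensorProduct.assoc R M H H (coact.rTensor H (coact m)) =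
    comul.lTensor M (coact m)
  counit : ∀ m : M, TensorProduct.rid R M ((counit (R := R) (A := H)).lTensor M (coact m)) = m
  compat : ∀ (m : M) (h : H), coact ((act h).unop m) = (diagAct act h).unop (coact m)

namespace HopfModuleData

/-- The action, as a linear map on `M ⊗ H`. -/
def actMap (𝓜 : HopfModuleData R H M) : M ⊗[R] H →ₗ[R] M :=
  TensorProduct.lift ((MulOpposite.opLinearEquiv R).symm.toLinearMap ∘ₗ 𝓜.act.toLinearMap).flip

@[simp] lemma actMap_tmul (𝓜 : HopfModuleData R H M) (m : M) (h : H) :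
    𝓜.actMap (m ⊗ₜ h) = (𝓜.act h).unop m := rfl

/-- This presents the twist as the comparison between `M ⊗ H` with `H` acting on the second factor
only and `M ⊗ H` with the diagonal action. -/
lemma diagAct_one_tmul (𝓜 : HopfModuleData R H M) (m : M) (h : H) :
    (diagAct 𝓜.act h).unop (m ⊗ₜ 1) = convTwist 𝓜.act.toLinearMap (m ⊗ₜ h) := by
  rw [diagAct_tmul, convTwist_tmul]
  simp [LinearMap.rTensor]

/-- The twist by the action is right linear. -/
lemma convTwist_mulRight (𝓜 : HopfModuleData R H M) (z : M ⊗[R] H) (h : H) :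
    convTwist 𝓜.act.toLinearMap ((LinearMap.mulRight R h).lTensor M z) =
      (diagAct 𝓜.act h).unop (convTwist 𝓜.act.toLinearMap z) := by
  induction z with
  | zero => simp
  | add u v hu hv => simp only [map_add, hu, hv]
  | tmul m k =>
    rw [← diagAct_one_tmul, LinearMap.lTensor_tmul, ← diagAct_one_tmul, LinearMap.mulRight_apply,
      map_mul, MulOpposite.unop_mul, Module.End.mul_apply]

lemma rid_counit_convTwist (𝓜 : HopfModuleData R H M) (z : M ⊗[R] H) :
    TensorProduct.rid R M ((Coalgebra.counit (R := R) (A := H)).lTensor M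
      (convTwist 𝓜.act.toLinearMap z)) = 𝓜.actMap z := by
  induction z with
  | zero => simp
  | add u v hu hv => simp only [map_add, hu, hv]
  | tmul m k =>
    have h : ∀ w : H ⊗[R] H, TensorProduct.rid R M ((Coalgebra.counit (R := R) (A := H)).lTensor M
        ((((MulOpposite.opLinearEquiv R).symm.toLinearMap ∘ₗ 𝓜.act.toLinearMap).flip m).rTensor
          H w)) = 𝓜.actMap (m ⊗ₜ TensorProduct.rid R H (Coalgebra.counit.lTensor H w)) := by
      intro w
      induction w with
      | zero => simp
      | add u v hu hv => simp only [map_add, TensorProduct.tmul_add, hu, hv]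
      | tmul p q => simp
    rw [convTwist_tmul, h, Coalgebra.lTensor_counit_comul]
    simp

/-- Naturality of the twist with respect to the coaction. -/
lemma rTensor_coact_convTwist (𝓜 : HopfModuleData R H M) (z : M ⊗[R] H) :
    𝓜.coact.rTensor H (convTwist 𝓜.act.toLinearMap z) =
      convTwist (diagAct 𝓜.act).toLinearMap (𝓜.coact.rTensor H z) := by
  induction z with
  | zero => simp
  | add u v hu hv => simp only [map_add, hu, hv]
  | tmul m k =>
    rw [LinearMap.rTensor_tmul, convTwist_tmul, convTwist_tmul]
    induction comul (R := R) k with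
    | zero => simp
    | add u v hu hv => simp only [map_add, hu, hv]
    | tmul p q => simp [𝓜.compat]

/-- On `m ⊗ h` both sides are `∑ m h₁ ⊗ h₂ ⊗ h₃`: colinearity of the twist is rewritten as a twist
for the diagonal action on `M ⊗ H`, so that it can later be cancelled. -/
lemma assoc_symm_comul_convTwist (𝓜 : HopfModuleData R H M) (z : M ⊗[R] H) :
    (TensorProduct.assoc R M H H).symm (comul.lTensor M (convTwist 𝓜.act.toLinearMap z)) =
      convTwist (diagAct 𝓜.act).toLinearMap
        (((TensorProduct.mk R M H).flip 1).rTensor H z) := by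
  induction z with
  | zero => simp
  | add u v hu hv => simp only [map_add, hu, hv]
  | tmul m k =>
    rw [lTensor_comul_convTwist, LinearEquiv.symm_apply_apply, LinearMap.rTensor_tmul,
      convTwist_tmul, LinearMap.lTensor_tmul]
    induction comul (R := R) k with
    | zero => simp
    | add u v hu hv => simp only [map_add, TensorProduct.tmul_add, hu, hv]
    | tmul p q => simp [diagAct_one_tmul]

end HopfModuleData

end HopfModule

/-! ### Splitting a Hopf module over a Hopf algebra. -/

section HopfModuleAntipode

variable {R H M : Type*} [CommRing R] [Ring H] [HopfAlgebra R H] [AddCommGroup M] [Module R M]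

namespace HopfModuleData

lemma convTwist_algHom_bijective (act : H →ₐ[R] (Module.End R M)ᵐᵒᵖ) :
    Function.Bijective (convTwist act.toLinearMap) :=
  convTwist_bijective (isUnit_toConv_comp act isUnit_toConv_id)

/-- The map `m ↦ ∑ m₀ S(m₁) ⊗ m₂`. -/
def split (𝓜 : HopfModuleData R H M) : M →ₗ[R] M ⊗[R] H :=
  (LinearEquiv.ofBijective _ (convTwist_algHom_bijective 𝓜.act)).symm.toLinearMap ∘ₗ 𝓜.coact

lemma convTwist_split (𝓜 : HopfModuleData R H M) (m : M) :
    convTwist 𝓜.act.toLinearMap (𝓜.split m) = 𝓜.coact m :=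
  (LinearEquiv.ofBijective _ (convTwist_algHom_bijective 𝓜.act)).apply_symm_apply _

/-- The coaction is linear for the diagonal action and the twist intertwines the two actions, so
undoing the twist leaves `H` acting on the second leg only. -/
lemma split_act (𝓜 : HopfModuleData R H M) (m : M) (h : H) :
    𝓜.split ((𝓜.act h).unop m) = (LinearMap.mulRight R h).lTensor M (𝓜.split m) := by
  apply (convTwist_algHom_bijective 𝓜.act).1
  rw [convTwist_split, convTwist_mulRight, convTwist_split, 𝓜.compat]

lemma actMap_split (𝓜 : HopfModuleData R H M) (m : M) : 𝓜.actMap (𝓜.split m) = m := by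
  rw [← rid_counit_convTwist, convTwist_split, 𝓜.counit]

/-- The first leg of `split m` is coinvariant, and a coinvariant `x` splits as `x ⊗ 1`. Working
inside the tensor product avoids introducing the submodule of coinvariants. -/
lemma rTensor_split_split (𝓜 : HopfModuleData R H M) (m : M) :
    𝓜.split.rTensor H (𝓜.split m) =
      ((TensorProduct.mk R M H).flip 1).rTensor H (𝓜.split m) := by
  have h1 : 𝓜.coact.rTensor H (𝓜.split m) =
      ((TensorProduct.mk R M H).flip 1).rTensor H (𝓜.split m) := by
    -- After twisting by the diagonal action, the claim becomes coassociativity of the coaction of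
    -- `M`.
    apply (convTwist_algHom_bijective (diagAct 𝓜.act)).1
    rw [← rTensor_coact_convTwist, ← assoc_symm_comul_convTwist, convTwist_split, ← 𝓜.coassoc,
      LinearEquiv.symm_apply_apply]
  rw [split, LinearMap.rTensor_comp, LinearMap.comp_apply, ← split, h1, ← LinearMap.comp_apply,
    ← LinearMap.rTensor_comp]
  congr 2
  ext x
  -- The twist fixes `x ⊗ 1`, hence so does its inverse.
  apply (convTwist_algHom_bijective 𝓜.act).1
  refine ((LinearEquiv.ofBijective _ (convTwist_algHom_bijective 𝓜.act)).apply_symm_apply _).trans ?_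
  simp [← diagAct_one_tmul]

end HopfModuleData

end HopfModuleAntipode

/-! ### The dual as a Hopf module, and bijectivity of the antipode. -/

section Antipode

variable {R H : Type*} [CommRing R] [Ring H] [HopfAlgebra R H]

variable (R H) in
/-- The right action `(f h)(k) = f (k S(h))` of `H` on its dual. -/
def dualAntipodeAct : H →ₐ[R] (Module.End R (H →ₗ[R] R))ᵐᵒᵖ :=
  AlgHom.ofLinearMap ((MulOpposite.opLinearEquiv R).toLinearMap ∘ₗ
      LinearMap.mk₂ R (fun h f => f ∘ₗ LinearMap.mulRight R (HopfAlgebra.antipode R h))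
        (fun _ _ _ => by ext; simp [mul_add]) (fun _ _ _ => by ext; simp)
        (fun _ _ _ => by ext; simp) (fun _ _ _ => by ext; simp))
    (MulOpposite.unop_injective (by ext; simp))
    (fun _ _ => MulOpposite.unop_injective (by
      ext; simp [HopfAlgebra.antipode_mul_antidistrib, mul_assoc]))

@[simp] lemma dualAntipodeAct_apply (f : H →ₗ[R] R) (h k : H) :
    (dualAntipodeAct R H h).unop f k = f (k * HopfAlgebra.antipode R h) := rfl

variable [Module.Free R H] [Module.Finite R H]

variable (R H) in
/-- The right coaction `f ↦ ∑ f₀ ⊗ f₁` on the dual, with `∑ f₀(k) f₁ = ∑ k₁ f(k₂)`. -/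
def dualCoact : (H →ₗ[R] R) →ₗ[R] (H →ₗ[R] R) ⊗[R] H :=
  (dualTensorHomEquiv R H H).symm.toLinearMap ∘ₗ
    LinearMap.mk₂ R (fun f k => TensorProduct.rid R H (f.lTensor H (comul k)))
      (fun _ _ _ => by simp [LinearMap.lTensor_add])
      (fun _ _ _ => by simp [LinearMap.lTensor_smul])
      (fun _ _ _ => by simp) (fun _ _ _ => by simp)

lemma dualTensorHom_dualCoact (f : H →ₗ[R] R) (k : H) :
    dualTensorHom R H H (dualCoact R H f) k = TensorProduct.rid R H (f.lTensor H (comul k)) :=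
  LinearMap.congr_fun ((dualTensorHomEquiv R H H).apply_symm_apply _) k

/-- Read as maps from `H` to `H ⊗ H`, both sides are `k ↦ ∑ k₁ ⊗ k₂ f(k₃)`. -/
lemma dualCoact_coassoc (f : H →ₗ[R] R) :
    TensorProduct.assoc R _ H H ((dualCoact R H).rTensor H (dualCoact R H f)) =
      comul.lTensor _ (dualCoact R H f) := by
  apply (dualTensorHomEquiv R H (H ⊗[R] H)).injective
  ext k
  change dualTensorHom R H (H ⊗[R] H) _ k = dualTensorHom R H (H ⊗[R] H) _ k
  have h1 : ∀ z, dualTensorHom R H (H ⊗[R] H)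
      (TensorProduct.assoc R _ H H ((dualCoact R H).rTensor H z)) k =
      (dualTensorHom R H H z).lTensor H (comul k) := by
    intro z
    induction z with
    | zero => simp
    | add u v hu hv => simp only [map_add, LinearMap.add_apply, LinearMap.lTensor_add, hu, hv]
    | tmul m h =>
      have h2 : ∀ y : (H →ₗ[R] R) ⊗[R] H, dualTensorHom R H (H ⊗[R] H)
          (TensorProduct.assoc R _ H H (y ⊗ₜ h)) k = dualTensorHom R H H y k ⊗ₜ h := by
        intro y
        induction y with
        | zero => simp
        | add u v hu hv =>
          simp only [map_add, TensorProduct.add_tmul, LinearMap.add_apply, hu, hv]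
        | tmul p q => simp [TensorProduct.smul_tmul']
      rw [LinearMap.rTensor_tmul, h2, dualTensorHom_dualCoact]
      induction comul (R := R) k with
      | zero => simp
      | add u v hu hv => simp only [map_add, TensorProduct.add_tmul, hu, hv]
      | tmul p q => simp [TensorProduct.smul_tmul]
  have h3 : ∀ z, dualTensorHom R H (H ⊗[R] H) (comul.lTensor _ z) k =
      comul (dualTensorHom R H H z k) := by
    intro z
    induction z with
    | zero => simp
    | add u v hu hv => simp only [map_add, LinearMap.add_apply, hu, hv]
    | tmul m h => simp
  let F : H ⊗[R] H →ₗ[R] H := (TensorProduct.rid R H).toLinearMap ∘ₗ f.lTensor H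
  have h4 : dualTensorHom R H H (dualCoact R H f) = F ∘ₗ comul :=
    LinearMap.ext (dualTensorHom_dualCoact f)
  have h5 : ∀ w : H ⊗[R] H, F.lTensor H (TensorProduct.assoc R H H H (comul.rTensor H w)) =
      comul (F w) := by
    intro w
    induction w with
    | zero => simp
    | add u v hu hv => simp only [map_add, hu, hv]
    | tmul p q =>
      have h6 : ∀ x : H ⊗[R] H,
          F.lTensor H (TensorProduct.assoc R H H H (x ⊗ₜ q)) = f q • x := by
        intro x
        induction x with
        | zero => simp
        | add u v hu hv => simp only [map_add, TensorProduct.add_tmul, smul_add, hu, hv]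
        | tmul a b => simp [F]
      simp [h6, F]
  rw [h1, h3, h4, LinearMap.lTensor_comp, LinearMap.comp_apply, ← Coalgebra.coassoc_apply, h5]
  rfl

lemma dualCoact_counit (f : H →ₗ[R] R) :
    TensorProduct.rid R _ ((counit (R := R) (A := H)).lTensor _ (dualCoact R H f)) = f := by
  ext k
  have h1 : ∀ z, TensorProduct.rid R (H →ₗ[R] R) ((counit (R := R) (A := H)).lTensor _ z) k =
      counit (dualTensorHom R H H z k) := by
    intro z
    induction z with
    | zero => simp
    | add u v hu hv => simp only [map_add, LinearMap.add_apply, hu, hv]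
    | tmul m h => simp [mul_comm]
  have h2 : ∀ w : H ⊗[R] H, counit (R := R) (TensorProduct.rid R H (f.lTensor H w)) =
      f (TensorProduct.lid R H (counit.rTensor H w)) := by
    intro w
    induction w with
    | zero => simp
    | add u v hu hv => simp only [map_add, hu, hv]
    | tmul p q => simp [mul_comm]
  rw [h1, dualTensorHom_dualCoact, h2, Coalgebra.rTensor_counit_comul]
  simp

/-- Evaluated at `k`, the right side is `∑ k₁ S(h₂) h₃ f(k₂ S(h₁))`, because `S` reverses the
comultiplication. The factor `S(h₂) h₃` collapses to a counit and leaves `∑ k₁ f(k₂ S(h))`, which is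
the left side. -/
lemma dualCoact_compat (f : H →ₗ[R] R) (h : H) :
    dualCoact R H ((dualAntipodeAct R H h).unop f) =
      (diagAct (dualAntipodeAct R H) h).unop (dualCoact R H f) := by
  apply (dualTensorHomEquiv R H H).injective
  ext k
  change dualTensorHom R H H _ k = dualTensorHom R H H _ k
  let S := HopfAlgebra.antipode R (A := H)
  let G (g : H →ₗ[R] H) : H ⊗[R] H →ₗ[R] H :=
    LinearMap.mul' R H ∘ₗ TensorProduct.map (g ∘ₗ LinearMap.mulLeft R k ∘ₗ S) LinearMap.id
  have h1 : ∀ z, dualTensorHom R H H ((diagAct (dualAntipodeAct R H) h).unop z) k =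
      G (dualTensorHom R H H z) (comul h) := by
    intro z
    induction z with
    | zero => simp [G]
    | add u v hu hv =>
      simp only [map_add, LinearMap.add_apply, hu, hv, G, LinearMap.add_comp,
        TensorProduct.map_add_left, LinearMap.comp_add]
    | tmul m q =>
      rw [diagAct_tmul]
      induction comul (R := R) h with
      | zero => simp
      | add u v hu hv => simp only [map_add, LinearMap.add_apply, hu, hv]
      | tmul a b => simp [G, S]
  rw [h1, dualTensorHom_dualCoact]
  let E (x : H ⊗[R] H) : H ⊗[R] H →ₗ[R] H :=
    (TensorProduct.rid R H).toLinearMap ∘ₗ f.lTensor H ∘ₗ LinearMap.mulLeft R x ∘ₗ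
      TensorProduct.map S S ∘ₗ (TensorProduct.comm R H H).toLinearMap
  have h2 : ∀ w, G (dualTensorHom R H H (dualCoact R H f)) w =
      LinearMap.mul' R H (((E (comul k)) ∘ₗ comul).rTensor H w) := by
    intro w
    induction w with
    | zero => simp
    | add u v hu hv => simp only [map_add, hu, hv]
    | tmul p q =>
      simp only [G, LinearMap.comp_apply, TensorProduct.map_tmul, LinearMap.mulLeft_apply,
        dualTensorHom_dualCoact, Bialgebra.comul_mul, LinearMap.rTensor_tmul, E, S, comul_antipode,
        LinearEquiv.coe_coe, LinearMap.id_apply]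
  rw [h2]
  induction comul (R := R) k with
  | zero => simp [E]
  | add u v hu hv =>
    have : E (u + v) = E u + E v := by ext; simp [E, add_mul]
    simp only [map_add, LinearMap.add_comp, LinearMap.rTensor_add, LinearMap.add_apply, ← hu, ← hv,
      this]
  | tmul a b =>
    let F : H →ₗ[R] H →ₗ[R] H :=
      LinearMap.mk₂ R (fun p x => f (b * S p) • (a * x)) (fun _ _ _ => by simp [mul_add, add_smul])
        (fun _ _ _ => by simp [mul_smul]) (fun _ _ _ => by simp [mul_add])
        (fun c p x => by rw [mul_smul_comm, smul_comm])
    have h3 : ∀ w : H ⊗[R] H, LinearMap.mul' R H ((E (a ⊗ₜ b) ∘ₗ comul).rTensor H w) =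
        TensorProduct.lift F ((LinearMap.mul' R H ∘ₗ S.rTensor H).lTensor H
          (TensorProduct.assoc R H H H (comul.rTensor H w))) := by
      intro w
      induction w with
      | zero => simp
      | add u v hu hv => simp only [map_add, hu, hv]
      | tmul p q =>
        simp only [LinearMap.rTensor_tmul, LinearMap.comp_apply]
        induction comul (R := R) p with
        | zero => simp
        | add u v hu hv => simp only [map_add, TensorProduct.add_tmul, hu, hv]
        | tmul c d => simp [E, F, mul_assoc]
    have h4 : ∀ w : H ⊗[R] H, TensorProduct.lift F ((LinearMap.mul' R H ∘ₗ S.rTensor H).lTensor H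
        (comul.lTensor H w)) = f (b * S (TensorProduct.rid R H (counit.lTensor H w))) • a := by
      intro w
      induction w with
      | zero => simp
      | add u v hu hv => simp only [map_add, mul_add, add_smul, hu, hv]
      | tmul p q =>
        simp [F, S, HopfAlgebra.mul_antipode_rTensor_comul_apply, Algebra.algebraMap_eq_smul_one,
          smul_smul]
    rw [h3, Coalgebra.coassoc_apply, h4, Coalgebra.lTensor_counit_comul]
    simp [S]

variable (R H) in
/-- The dual of `H` as a right Hopf module. -/
def dualHopfModule : HopfModuleData R H (H →ₗ[R] R) where
  act := dualAntipodeAct R H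
  coact := dualCoact R H
  coassoc := dualCoact_coassoc
  counit := dualCoact_counit
  compat := dualCoact_compat

variable (R H) in
/-- The antipode of a Hopf algebra which is free of finite rank is bijective. -/
theorem antipode_bijective : Function.Bijective (HopfAlgebra.antipode R (A := H)) := by
  let S := HopfAlgebra.antipode R (A := H)
  let 𝓜 := dualHopfModule R H
  let z := 𝓜.split counit
  -- `Λ p q x` splits the functional `k ↦ p(k x)` and evaluates the first leg at `S q`. For `x = S
  -- h` that functional is `p · h`, so linearity of the splitting pulls out the factor `h`.
  let Λ : (H →ₗ[R] R) →ₗ[R] H →ₗ[R] H →ₗ[R] H :=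
    LinearMap.mk₂ R (fun p q =>
      (LinearMap.applyₗ (S q) ∘ₗ dualTensorHom R H H) ∘ₗ 𝓜.split ∘ₗ
        (LinearMap.llcomp R H H R p ∘ₗ (LinearMap.mul R H).flip))
      (fun _ _ _ => by ext; simp [LinearMap.add_comp])
      (fun _ _ _ => by ext; simp [LinearMap.smul_comp])
      (fun _ _ _ => by ext; simp)
      (fun _ _ _ => by ext; simp)
  have hΛ : ∀ h, TensorProduct.lift Λ z (S h) = h := by
    intro h
    let Ψ : ((H →ₗ[R] R) ⊗[R] H) ⊗[R] H →ₗ[R] H := LinearMap.mulRight R h ∘ₗ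
      TensorProduct.lift ((dualTensorHom R H H).compl₂ S)
    have h1 : ∀ y, TensorProduct.lift Λ y (S h) = Ψ (𝓜.split.rTensor H y) := by
      intro y
      induction y with
      | zero => simp
      | add u v hu hv => simp only [map_add, LinearMap.add_apply, hu, hv]
      | tmul p q =>
        have h2 : ∀ x, dualTensorHom R H H ((LinearMap.mulRight R h).lTensor _ x) (S q) =
            dualTensorHom R H H x (S q) * h := by
          intro x
          induction x with
          | zero => simp
          | add u v hu hv => simp only [map_add, LinearMap.add_apply, add_mul, hu, hv]
          | tmul a b => simp
        exact (congrArg (fun x => dualTensorHom R H H x (S q)) (𝓜.split_act p h)).trans (h2 _)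
    -- Coinvariance of the first leg of `z` reduces the remaining factor to `∑ p(S q)`. This is the
    -- value at `1` of `𝓜.actMap z = ε`, hence `1`.
    have h3 : ∀ y, Ψ (((TensorProduct.mk R _ H).flip 1).rTensor H y) = 𝓜.actMap y 1 • h := by
      intro y
      induction y with
      | zero => simp
      | add u v hu hv => simp only [map_add, LinearMap.add_apply, add_smul, hu, hv]
      | tmul p q =>
        have : 𝓜.actMap (p ⊗ₜ q) 1 = p (1 * S q) := rfl
        rw [this]
        simp [Ψ]
    rw [h1, 𝓜.rTensor_split_split, h3, 𝓜.actMap_split]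
    simp
  have hsurj : Function.Surjective (TensorProduct.lift Λ z) := fun h => ⟨S h, hΛ h⟩
  -- So far the map is only a left inverse of `S`. Being surjective on a finite module it is
  -- injective, and therefore a two-sided inverse.
  have hinj := OrzechProperty.injective_of_surjective_endomorphism _ hsurj
  exact ⟨fun x y h => by rw [← hΛ x, ← hΛ y]; exact congrArg _ h,
    fun x => ⟨TensorProduct.lift Λ z x, hinj (hΛ _)⟩⟩

end Antipode

/-! ### The inverse of the antipode. -/

section AntipodeInv

variable {R H : Type*} [CommRing R] [Ring H] [HopfAlgebra R H] [Module.Free R H] [Module.Finite R H]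

variable (R H) in
/-- The antipode, as a linear equivalence. -/
def antipodeEquiv : H ≃ₗ[R] H := LinearEquiv.ofBijective _ (antipode_bijective R H)

variable (R H) in
/-- The inverse of the antipode. -/
def antipodeInv : H →ₗ[R] H := (antipodeEquiv R H).symm.toLinearMap

@[simp] lemma antipode_antipodeInv (h : H) : HopfAlgebra.antipode R (antipodeInv R H h) = h :=
  (antipodeEquiv R H).apply_symm_apply h

@[simp] lemma antipodeInv_antipode (h : H) : antipodeInv R H (HopfAlgebra.antipode R h) = h :=
  (antipodeEquiv R H).symm_apply_apply h

lemma antipodeInv_mul (h k : H) :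
    antipodeInv R H (h * k) = antipodeInv R H k * antipodeInv R H h := by
  apply (antipode_bijective R H).1
  simp [HopfAlgebra.antipode_mul_antidistrib]

lemma counit_antipodeInv (h : H) : counit (R := R) (antipodeInv R H h) = counit (R := R) h := by
  rw [← HopfAlgebra.counit_antipode, antipode_antipodeInv]

lemma comul_antipodeInv (h : H) : comul (R := R) (antipodeInv R H h) =
    TensorProduct.map (antipodeInv R H) (antipodeInv R H) (TensorProduct.comm R H H (comul h)) := by
  obtain ⟨h, rfl⟩ := (antipode_bijective R H).2 h
  rw [antipodeInv_antipode, comul_antipode]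
  induction comul (R := R) h with
  | zero => simp
  | add u v hu hv => simp only [map_add, ← hu, ← hv]
  | tmul p q => simp

/-- The identity `∑ h₂ S⁻¹(h₁) = ε(h)`. -/
lemma mul_antipodeInv_comm_comul (h : H) : LinearMap.mul' R H
    ((antipodeInv R H).lTensor H (TensorProduct.comm R H H (comul h))) =
      algebraMap R H (counit h) := by
  apply (antipode_bijective R H).1
  have h1 : ∀ w : H ⊗[R] H, HopfAlgebra.antipode R (LinearMap.mul' R H
      ((antipodeInv R H).lTensor H (TensorProduct.comm R H H w))) =
      LinearMap.mul' R H ((HopfAlgebra.antipode R).lTensor H w) := by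
    intro w
    induction w with
    | zero => simp
    | add u v hu hv => simp only [map_add, hu, hv]
    | tmul p q => simp [HopfAlgebra.antipode_mul_antidistrib]
  rw [h1, HopfAlgebra.mul_antipode_lTensor_comul_apply]
  simp [Algebra.algebraMap_eq_smul_one]

/-- The identity `∑ S⁻¹(h₂) h₁ = ε(h)`. -/
lemma antipodeInv_mul_comm_comul (h : H) : LinearMap.mul' R H
    ((antipodeInv R H).rTensor H (TensorProduct.comm R H H (comul h))) =
      algebraMap R H (counit h) := by
  apply (antipode_bijective R H).1
  have h1 : ∀ w : H ⊗[R] H, HopfAlgebra.antipode R (LinearMap.mul' R H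
      ((antipodeInv R H).rTensor H (TensorProduct.comm R H H w))) =
      LinearMap.mul' R H ((HopfAlgebra.antipode R).rTensor H w) := by
    intro w
    induction w with
    | zero => simp
    | add u v hu hv => simp only [map_add, hu, hv]
    | tmul p q => simp [HopfAlgebra.antipode_mul_antidistrib]
  rw [h1, HopfAlgebra.mul_antipode_rTensor_comul_apply]
  simp [Algebra.algebraMap_eq_smul_one]

end AntipodeInv

/-! ### Operators on a comodule algebra defined by its coaction. -/

section Translate

variable {R H B : Type*} [CommRing R] [Ring H] [Bialgebra R H] [Ring B] [Algebra R B]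
  [ComoduleAlgebra R H B]

/-- The endomorphism `b ↦ ∑ b₀ g(b₁)` of a comodule algebra. -/
def translate : (H →ₗ[R] R) →ₗ[R] B →ₗ[R] B :=
  LinearMap.mk₂ R
    (fun g b => TensorProduct.rid R B (g.lTensor B (ComoduleAlgebra.coaction (R := R) (H := H) b)))
    (fun _ _ _ => by simp [LinearMap.lTensor_add]) (fun _ _ _ => by simp [LinearMap.lTensor_smul])
    (fun _ _ _ => by simp) (fun _ _ _ => by simp)

lemma translate_apply (g : H →ₗ[R] R) (b : B) : translate g b =
    TensorProduct.rid R B (g.lTensor B (ComoduleAlgebra.coaction (R := R) (H := H) b)) := rfl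

lemma translate_counit (b : B) : translate (counit (R := R) (A := H)) b = b := by
  rw [translate_apply, ComoduleAlgebra.counit]
  simp

/-- Coassociativity turns both sides into `∑ b₀ f(b₁) g(b₂)`: a right comodule is a left module over
the convolution algebra `H^*`. -/
lemma translate_translate (f g : H →ₗ[R] R) (b : B) :
    translate f (translate g b) = translate (dualConv R H f g) b := by
  let E : B ⊗[R] (H ⊗[R] H) →ₗ[R] B := (TensorProduct.rid R B).toLinearMap ∘ₗ
    (LinearMap.mul' R R ∘ₗ TensorProduct.map f g).lTensor B
  have h1 : ∀ w : B ⊗[R] H, translate f (TensorProduct.rid R B (g.lTensor B w)) =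
      E (TensorProduct.assoc R B H H
        ((ComoduleAlgebra.coaction (R := R) (H := H) (B := B)).toLinearMap.rTensor H w)) := by
    intro w
    induction w with
    | zero => simp
    | add u v hu hv => simp only [map_add, hu, hv]
    | tmul p q =>
      simp only [LinearMap.lTensor_tmul, TensorProduct.rid_tmul, map_smul, translate_apply,
        LinearMap.rTensor_tmul, AlgHom.toLinearMap_apply]
      induction ComoduleAlgebra.coaction (R := R) (H := H) p with
      | zero => simp
      | add u v hu hv => simp only [map_add, TensorProduct.add_tmul, smul_add, hu, hv]
      | tmul a b => simp [E, smul_smul, mul_comm]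
  rw [translate_apply g, h1, ComoduleAlgebra.coassoc, translate_apply]
  induction ComoduleAlgebra.coaction (R := R) (H := H) b with
  | zero => simp
  | add u v hu hv => simp only [map_add, hu, hv]
  | tmul p q => simp [E, dualConv_def]

/-- The endomorphism `b ⊗ f ↦ ∑ b₀ ⊗ f φ(b₁)` of `B ⊗ H^*`. -/
def coactTwist (φ : H →ₗ[R] H) : B ⊗[R] (H →ₗ[R] R) →ₗ[R] B ⊗[R] (H →ₗ[R] R) :=
  TensorProduct.lift <| LinearMap.mk₂ R
    (fun b f => (dualAct R H f ∘ₗ φ).lTensor B (ComoduleAlgebra.coaction (R := R) (H := H) b))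
    (fun _ _ _ => by simp) (fun _ _ _ => by simp)
    (fun _ _ _ => by simp [LinearMap.add_comp, LinearMap.lTensor_add])
    (fun _ _ _ => by simp [LinearMap.smul_comp, LinearMap.lTensor_smul])

lemma coactTwist_tmul (φ : H →ₗ[R] H) (b : B) (f : H →ₗ[R] R) : coactTwist φ (b ⊗ₜ f) =
    (dualAct R H f ∘ₗ φ).lTensor B (ComoduleAlgebra.coaction (R := R) (H := H) b) := rfl

/-- The composite sends `b ⊗ f` to `∑ b₀ ⊗ f φ(b₂) ψ(b₁)`, in which the hypothesis cancels the two
factors in their reversed order. -/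
lemma coactTwist_coactTwist_eq_self (φ ψ : H →ₗ[R] H)
    (h : ∀ k : H, LinearMap.mul' R H (TensorProduct.map φ ψ (TensorProduct.comm R H H (comul k))) =
      algebraMap R H (counit k)) (z : B ⊗[R] (H →ₗ[R] R)) :
    coactTwist ψ (coactTwist φ z) = z := by
  induction z with
  | zero => simp
  | add u v hu hv => simp only [map_add, hu, hv]
  | tmul b f =>
    let E : B ⊗[R] (H ⊗[R] H) →ₗ[R] B ⊗[R] (H →ₗ[R] R) :=
      (dualAct R H f ∘ₗ LinearMap.mul' R H ∘ₗ TensorProduct.map φ ψ ∘ₗ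
        (TensorProduct.comm R H H).toLinearMap).lTensor B
    have h1 : ∀ w : B ⊗[R] H, coactTwist ψ ((dualAct R H f ∘ₗ φ).lTensor B w) =
        E (TensorProduct.assoc R B H H
          ((ComoduleAlgebra.coaction (R := R) (H := H) (B := B)).toLinearMap.rTensor H w)) := by
      intro w
      induction w with
      | zero => simp
      | add u v hu hv => simp only [map_add, hu, hv]
      | tmul c g =>
        simp only [LinearMap.lTensor_tmul, coactTwist_tmul, LinearMap.rTensor_tmul,
          AlgHom.toLinearMap_apply]
        induction ComoduleAlgebra.coaction (R := R) (H := H) c with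
        | zero => simp
        | add u v hu hv => simp only [map_add, TensorProduct.add_tmul, hu, hv]
        | tmul a k => simp [E, dualAct_mul]
    have h2 : ∀ w : B ⊗[R] H, E (comul.lTensor B w) =
        (LinearMap.toSpanSingleton R _ f).lTensor B (counit.lTensor B w) := by
      intro w
      induction w with
      | zero => simp
      | add u v hu hv => simp only [map_add, hu, hv]
      | tmul c g => simp [E, h, Algebra.algebraMap_eq_smul_one, dualAct_one]
    rw [coactTwist_tmul, h1, ComoduleAlgebra.coassoc, h2, ComoduleAlgebra.counit]
    simp

end Translate

/-! ### Identification of `B ⊗ H^*` with `Hom(H, B)`. -/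

section TensorDual

variable {R H B : Type*} [CommRing R] [Ring H] [HopfAlgebra R H] [Module.Free R H]
  [Module.Finite R H] [Ring B] [Algebra R B]

variable (R H B) in
/-- The isomorphism `b ⊗ f ↦ (h ↦ f(S⁻¹(h)) b)`. -/
def tensorDualEquiv : B ⊗[R] (H →ₗ[R] R) ≃ₗ[R] (H →ₗ[R] B) :=
  TensorProduct.comm R B (H →ₗ[R] R) ≪≫ₗ dualTensorHomEquiv R H B ≪≫ₗ
    LinearEquiv.congrLeft B R (antipodeEquiv R H)

lemma tensorDualEquiv_tmul (b : B) (f : H →ₗ[R] R) (h : H) :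
    tensorDualEquiv R H B (b ⊗ₜ f) h = f (antipodeInv R H h) • b := rfl

end TensorDual

/-! ### The right representation of the smash product on `B`. -/

section SmashRepresentation

variable {R H B : Type*} [CommRing R] [Ring H] [HopfAlgebra R H] [Module.Free R H]
  [Module.Finite R H] [Ring B] [Algebra R B] [ComoduleAlgebra R H B]

/-- `S⁻¹` reverses the comultiplication, which converts the left action of `H^*` by translations
into a right action. -/
lemma dualConv_comp_antipodeInv (f g : H →ₗ[R] R) : dualConv R H f g ∘ₗ antipodeInv R H =
    dualConv R H (g ∘ₗ antipodeInv R H) (f ∘ₗ antipodeInv R H) := by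
  ext h
  simp only [dualConv_def, LinearMap.comp_apply, LinearMap.convMul_apply, comul_antipodeInv]
  induction comul (R := R) h with
  | zero => simp
  | add u v hu hv => simp only [map_add, hu, hv]
  | tmul p q => simp [mul_comm]

/-- The map `b # f ↦ (x ↦ ∑ (x b)₀ f(S⁻¹((x b)₁)))`. -/
def smashRight : B ⊗[R] (H →ₗ[R] R) →ₗ[R] Module.End R B :=
  TensorProduct.lift <| LinearMap.mk₂ R
    (fun b f => translate (f ∘ₗ antipodeInv R H) ∘ₗ LinearMap.mulRight R b)
    (fun _ _ _ => by ext; simp [mul_add]) (fun _ _ _ => by ext; simp)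
    (fun _ _ _ => by ext; simp [LinearMap.add_comp])
    (fun _ _ _ => by ext; simp [LinearMap.smul_comp])

lemma smashRight_tmul (b x : B) (f : H →ₗ[R] R) :
    smashRight (b ⊗ₜ f) x = translate (f ∘ₗ antipodeInv R H) (x * b) := rfl

lemma smashRight_one : smashRight ((1 : B) ⊗ₜ counit (R := R) (A := H)) = LinearMap.id := by
  ext x
  have : counit ∘ₗ antipodeInv R H = counit (R := R) (A := H) := LinearMap.ext counit_antipodeInv
  rw [smashRight_tmul, this, mul_one, translate_counit]
  rfl

/-- This is multiplicativity on the product of `1 # f` and `b # ε`. The left side is `∑ x₀ b₀ f(b₂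
S⁻¹(b₁) S⁻¹(x₁))`, and `∑ h₂ S⁻¹(h₁) = ε(h)` removes the inner factors; this is why `S⁻¹` appears in
the action. -/
lemma smashRight_smashTwist (b x : B) (f : H →ₗ[R] R) :
    smashRight (smashTwist R H B f b) x = translate (f ∘ₗ antipodeInv R H) x * b := by
  let T := antipodeInv R H
  let ρ := ComoduleAlgebra.coaction (R := R) (H := H) (B := B)
  let Q (z : B ⊗[R] H) : B ⊗[R] H →ₗ[R] B := TensorProduct.lift <| LinearMap.mk₂ R
    (fun c g => TensorProduct.rid R B ((dualAct R H f g ∘ₗ T).lTensor B (z * ρ c)))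
    (fun _ _ _ => by simp [mul_add]) (fun _ _ _ => by simp)
    (fun _ _ _ => by simp [LinearMap.add_comp, LinearMap.lTensor_add])
    (fun _ _ _ => by simp [LinearMap.smul_comp, LinearMap.lTensor_smul])
  have h1 : ∀ w, smashRight ((dualAct R H f).lTensor B w) x = Q (ρ x) w := by
    intro w
    induction w with
    | zero => simp
    | add u v hu hv => simp only [map_add, LinearMap.add_apply, hu, hv]
    | tmul c g => simp [smashRight_tmul, Q, translate_apply, T, ρ]
  have h2 : ∀ z, Q z (ρ b) = TensorProduct.rid R B ((f ∘ₗ T).lTensor B z) * b := by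
    intro z
    induction z with
    | zero =>
      have : Q 0 = 0 := by ext; simp [Q]
      simp [this]
    | add u v hu hv =>
      have : Q (u + v) = Q u + Q v := by ext; simp [Q, add_mul]
      simp only [this, map_add, LinearMap.add_apply, add_mul, hu, hv]
    | tmul p q =>
      let E : B ⊗[R] (H ⊗[R] H) →ₗ[R] B := (TensorProduct.rid R B).toLinearMap ∘ₗ
        TensorProduct.map (LinearMap.mulLeft R p) (f ∘ₗ LinearMap.mulRight R (T q) ∘ₗ
          LinearMap.mul' R H ∘ₗ T.lTensor H ∘ₗ (TensorProduct.comm R H H).toLinearMap)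
      have h3 : ∀ w, Q (p ⊗ₜ q) w = E (TensorProduct.assoc R B H H (ρ.toLinearMap.rTensor H w)) := by
        intro w
        induction w with
        | zero => simp
        | add u v hu hv => simp only [map_add, hu, hv]
        | tmul c g =>
          simp only [Q, TensorProduct.lift.tmul, LinearMap.mk₂_apply, LinearMap.rTensor_tmul,
            AlgHom.toLinearMap_apply]
          induction ρ c with
          | zero => simp
          | add u v hu hv => simp only [map_add, mul_add, TensorProduct.add_tmul, hu, hv]
          | tmul a k => simp [E, T, antipodeInv_mul, mul_assoc]
      have h4 : ∀ w : B ⊗[R] H, E (comul.lTensor B w) =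
          f (T q) • (p * TensorProduct.rid R B (counit.lTensor B w)) := by
        intro w
        induction w with
        | zero => simp
        | add u v hu hv => simp only [map_add, mul_add, smul_add, hu, hv]
        | tmul c g =>
          simp [E, T, mul_antipodeInv_comm_comul, Algebra.algebraMap_eq_smul_one, smul_smul,
            mul_comm]
      rw [h3, ComoduleAlgebra.coassoc, h4, ComoduleAlgebra.counit]
      simp [T]
  rw [smashTwist_apply, h1, h2]
  rfl

lemma smashRight_smashMul (u v : B ⊗[R] (H →ₗ[R] R)) :
    smashRight (smashMul R H B u v) = smashRight v ∘ₗ smashRight u := by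
  induction u with
  | zero => simp
  | add u u' h h' => simp only [map_add, LinearMap.add_apply, LinearMap.comp_add, h, h']
  | tmul b f =>
  induction v with
  | zero => simp
  | add u u' h h' => simp only [map_add, LinearMap.add_comp, h, h']
  | tmul b' f' =>
  ext x
  have h1 : ∀ w, smashRight (TensorProduct.map (LinearMap.mul R B b) ((dualConv R H).flip f') w) x =
      translate (f' ∘ₗ antipodeInv R H) (smashRight w (x * b)) := by
    intro w
    induction w with
    | zero => simp
    | add u v hu hv => simp only [map_add, LinearMap.add_apply, hu, hv]
    | tmul c g =>
      simp [smashRight_tmul, dualConv_comp_antipodeInv, translate_translate, mul_assoc]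
  rw [smashMul_tmul, h1, smashRight_smashTwist]
  rfl

lemma coactTwist_antipodeInv_bijective :
    Function.Bijective (coactTwist (B := B) (antipodeInv R H)) :=
  Function.bijective_iff_has_inverse.2 ⟨coactTwist LinearMap.id,
    coactTwist_coactTwist_eq_self _ _ antipodeInv_mul_comm_comul,
    coactTwist_coactTwist_eq_self _ _ mul_antipodeInv_comm_comul⟩

/-- On the image of a colinear map `γ`, the representation is a convolution product with `γ`. -/
lemma smashRight_apply_of_colinear (γ : H →ₗ[R] B)
    (hγ : ∀ h, ComoduleAlgebra.coaction (R := R) (H := H) (γ h) = γ.rTensor H (comul h))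
    (z : B ⊗[R] (H →ₗ[R] R)) :
    smashRight z ∘ₗ γ = (toConv γ * toConv (tensorDualEquiv R H B
      (coactTwist (antipodeInv R H) z))).ofConv := by
  ext h
  simp only [LinearMap.comp_apply, LinearMap.convMul_apply]
  induction z with
  | zero => simp
  | add u v hu hv =>
    simp only [map_add, LinearMap.add_apply, TensorProduct.map_add_right, hu, hv]
  | tmul b f =>
    -- By colinearity the value at `h` is `∑ γ(h₁) b₀ f(S⁻¹(h₂ b₁))`, and `S⁻¹(h₂ b₁) = S⁻¹(b₁)
    -- S⁻¹(h₂)` separates `b₁` from `h₂`.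
    rw [smashRight_tmul, translate_apply, map_mul, hγ, coactTwist_tmul]
    induction comul (R := R) h with
    | zero => simp
    | add u v hu hv => simp only [map_add, add_mul, hu, hv]
    | tmul p q =>
      rw [TensorProduct.map_tmul, LinearMap.mul'_apply]
      induction ComoduleAlgebra.coaction (R := R) (H := H) b with
      | zero => simp
      | add u v hu hv => simp only [map_add, mul_add, LinearMap.add_apply, hu, hv]
      | tmul c g => simp [tensorDualEquiv_tmul, antipodeInv_mul]

/-- The representation is faithful, and every linear map on the image of an invertible colinear map
`γ` comes from it. -/
lemma smashRight_comp_bijective (γ : H →ₗ[R] B)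
    (hγ : ∀ h, ComoduleAlgebra.coaction (R := R) (H := H) (γ h) = γ.rTensor H (comul h))
    (hu : IsUnit (toConv γ)) :
    Function.Bijective fun z : B ⊗[R] (H →ₗ[R] R) => smashRight z ∘ₗ γ := by
  have h1 : Function.Bijective fun F : H →ₗ[R] B => (toConv γ * toConv F).ofConv :=
    (WithConv.ofConv_bijective.comp hu.unit.mulLeft_bijective).comp WithConv.toConv_bijective
  have := (h1.comp (tensorDualEquiv R H B).bijective).comp coactTwist_antipodeInv_bijective
  convert this using 2 with z
  exact smashRight_apply_of_colinear γ hγ z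

end SmashRepresentation

/-! ### Matrices of left linear endomorphisms. -/

section RowMatrix

variable {R A M : Type*} [CommRing R] [Ring A] [Algebra R A] [AddCommGroup M] [Module R M]
  [Module A M] [IsScalarTower R A M] [SMulCommClass A R M] {n : ℕ} (e : M ≃ₗ[A] (Fin n → A))

/-- The matrix of an endomorphism of a left `A`-module in coordinates `e`, acting on row vectors. -/
def rowMatrix : Module.End A M →ₗ[R] Matrix (Fin n) (Fin n) A where
  toFun φ := LinearMap.toMatrixRight' (e.toLinearMap ∘ₗ φ ∘ₗ e.symm.toLinearMap)
  map_add' φ ψ := by rw [LinearMap.add_comp, LinearMap.comp_add, map_add]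
  -- As `A` need not be commutative, `R`-linearity is checked on entries, with scalars passing
  -- through `e` by the tower `R → A`.
  map_smul' r φ := by
    ext i j
    have : e (r • φ (e.symm (Pi.single i 1))) = r • e (φ (e.symm (Pi.single i 1))) :=
      LinearMap.map_smul_of_tower e.toLinearMap r _
    exact congrFun this j

lemma rowMatrix_apply (φ : Module.End A M) : rowMatrix (R := R) e φ =
    LinearMap.toMatrixRight' (e.toLinearMap ∘ₗ φ ∘ₗ e.symm.toLinearMap) := rfl

lemma rowMatrix_id : rowMatrix (R := R) e LinearMap.id = 1 := by
  rw [rowMatrix_apply, LinearMap.id_comp, LinearEquiv.comp_symm, LinearMap.toMatrixRight'_id]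

lemma rowMatrix_comp (φ ψ : Module.End A M) :
    rowMatrix (R := R) e (φ ∘ₗ ψ) = rowMatrix (R := R) e ψ * rowMatrix (R := R) e φ := by
  rw [rowMatrix_apply, rowMatrix_apply, rowMatrix_apply, ← LinearMap.toMatrixRight'_comp]
  congr 1
  exact LinearMap.ext fun x => by simp

lemma rowMatrix_bijective : Function.Bijective (rowMatrix (R := R) e) :=
  LinearMap.toMatrixRight'.bijective.comp (LinearEquiv.conjRingEquiv e).bijective

end RowMatrix

/-! ### The section `h ↦ 1 # h` and its twist. -/

section CrossedSection

variable {R H A : Type*} [CommRing R] [Ring H] [Bialgebra R H] [Ring A] [Algebra R A]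
  (α : WeakAction R H A) (σ : H ⊗[R] H →ₗ[R] A)

lemma WeakAction.act_one (h : H) : α.act h 1 = algebraMap R A (counit h) :=
  LinearMap.congr_fun (congrArg ofConv α.map_one') h

/-- Since `h₁ 1 = ε(h₁) 1`, the action disappears and the product is `∑ a σ(h₁ ⊗ k₁) # h₂ k₂`. -/
lemma crossedMul_one_tmul (a : A) (h k : H) : crossedMul α σ (a ⊗ₜ h) (1 ⊗ₜ k) =
    (LinearMap.mul' R H).lTensor A (mulTwist σ (a ⊗ₜ (h ⊗ₜ k))) := by
  have h1 : ∀ w : H ⊗[R] H, crossedAux α σ a 1 k w =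
      (a ⊗ₜ 1) * cocycleMap σ (TensorProduct.lid R H (counit.rTensor H w) ⊗ₜ k) := by
    intro w
    induction w with
    | zero => simp
    | add u v hu hv => simp only [map_add, TensorProduct.add_tmul, mul_add, hu, hv]
    | tmul p q =>
      rw [crossedAux_tmul, α.act_one]
      simp [Algebra.algebraMap_eq_smul_one, ← TensorProduct.smul_tmul']
  rw [crossedMul_tmul, h1, Coalgebra.rTensor_counit_comul, mulTwist_tmul, cocycleMap,
    TensorProduct.lid_tmul, one_smul, LinearMap.comp_apply]
  induction comul (R := R) (h ⊗ₜ[R] k) with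
  | zero => simp
  | add u v hu hv => simp only [map_add, mul_add, hu, hv]
  | tmul p q => simp

/-- The embedding `h ↦ 1 # h` of `H` into `A #_σ H`. -/
def crossedSection : H →ₗ[R] CrossedProduct α σ :=
  (CrossedProduct.ofTensor α σ).toLinearMap ∘ₗ TensorProduct.mk R A H 1

lemma crossedSection_apply (h : H) :
    crossedSection α σ h = CrossedProduct.ofTensor α σ (1 ⊗ₜ h) := rfl

lemma coaction_eq_crossedCoaction [IsCrossedProduct α σ] (b : CrossedProduct α σ) :
    ComoduleAlgebra.coaction (R := R) (H := H) b = crossedCoaction α σ b := rfl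

lemma coaction_crossedSection [IsCrossedProduct α σ] (h : H) :
    ComoduleAlgebra.coaction (R := R) (H := H) (crossedSection α σ h) =
      (crossedSection α σ).rTensor H (comul h) := by
  rw [coaction_eq_crossedCoaction, crossedSection_apply, crossedCoaction_tmul α σ 1 (ℛ R h)]
  conv_rhs => rw [← (ℛ R h).eq]
  simp [crossedSection_apply]

/-- The canonical map of `A #_σ H` is the composite of those of `σ` and of `H`. -/
lemma mulTwist_crossedSection [IsCrossedProduct α σ] (z : A ⊗[R] (H ⊗[R] H)) :
    mulTwist (crossedSection α σ) ((CrossedProduct.ofTensor α σ).toLinearMap.rTensor H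
      ((TensorProduct.assoc R A H H).symm z)) =
    (CrossedProduct.ofTensor α σ).toLinearMap.rTensor H ((TensorProduct.assoc R A H H).symm
      ((mulTwist (LinearMap.id : H →ₗ[R] H)).lTensor A (mulTwist σ z))) := by
  induction z with
  | zero => simp
  | add u v hu hv => simp only [map_add, hu, hv]
  | tmul a y =>
  induction y with
  | zero => simp
  | add u v hu hv => simp only [map_add, TensorProduct.tmul_add, hu, hv]
  | tmul h k =>
  have h1 : ∀ v : H ⊗[R] H, (LinearMap.mulLeft R (CrossedProduct.ofTensor α σ (a ⊗ₜ h)) ∘ₗ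
      crossedSection α σ).rTensor H v =
      ((CrossedProduct.ofTensor α σ).toLinearMap ∘ₗ (LinearMap.mul' R H).lTensor A ∘ₗ
        mulTwist σ ∘ₗ TensorProduct.mk R A _ a ∘ₗ TensorProduct.mk R H H h).rTensor H v := by
    intro v
    congr 2
    ext k
    simp [CrossedProduct.mul_def, crossedSection_apply, crossedMul_one_tmul]
  rw [TensorProduct.assoc_symm_tmul, LinearMap.rTensor_tmul, LinearEquiv.coe_coe, mulTwist_tmul, h1,
    mulTwist_tmul, TensorProduct.comul_tmul]
  -- Both sides are `∑ a σ(h₁ ⊗ k₁) # h₂ k₂ ⊗ k₃`. They differ only in how the double coproduct of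
  -- `k` is bracketed, so the coproduct of `h` is fixed and coassociativity is applied to `k`.
  let F (p q : H) : H ⊗[R] (H ⊗[R] H) →ₗ[R] CrossedProduct α σ ⊗[R] H :=
    ((CrossedProduct.ofTensor α σ).toLinearMap ∘ₗ TensorProduct.map (LinearMap.mulLeft R a ∘ₗ σ ∘ₗ
      TensorProduct.mk R H H p) (LinearMap.mulLeft R q)).rTensor H ∘ₗ
      (TensorProduct.assoc R H H H).symm.toLinearMap
  have h2 : ∀ v : H ⊗[R] H, ((CrossedProduct.ofTensor α σ).toLinearMap ∘ₗ
      (LinearMap.mul' R H).lTensor A ∘ₗ mulTwist σ ∘ₗ TensorProduct.mk R A _ a ∘ₗ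
        TensorProduct.mk R H H h).rTensor H v =
      ∑ i ∈ (ℛ R h).index, F ((ℛ R h).left i) ((ℛ R h).right i)
        (TensorProduct.assoc R H H H (comul.rTensor H v)) := by
    intro v
    induction v with
    | zero => simp
    | add u v hu hv => simp only [map_add, hu, hv, Finset.sum_add_distrib]
    | tmul x y =>
      simp only [LinearMap.rTensor_tmul, LinearMap.comp_apply, TensorProduct.mk_apply,
        mulTwist_tmul, TensorProduct.comul_tmul]
      rw [← (ℛ R h).eq]
      induction comul (R := R) x with
      | zero => simp
      | add u v hu hv =>
        simp only [map_add, TensorProduct.tmul_add, TensorProduct.add_tmul, hu, hv,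
          Finset.sum_add_distrib]
      | tmul c d => simp [F, TensorProduct.sum_tmul]
  have h3 : ∀ v : H ⊗[R] H, (CrossedProduct.ofTensor α σ).toLinearMap.rTensor H
      ((TensorProduct.assoc R A H H).symm ((mulTwist (LinearMap.id : H →ₗ[R] H)).lTensor A
        ((LinearMap.mulLeft R a ∘ₗ σ).rTensor (H ⊗[R] H)
          (TensorProduct.AlgebraTensorModule.tensorTensorTensorComm R R R R H H H H
            (comul h ⊗ₜ v))))) =
      ∑ i ∈ (ℛ R h).index, F ((ℛ R h).left i) ((ℛ R h).right i) (comul.lTensor H v) := by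
    intro v
    rw [← (ℛ R h).eq]
    induction v with
    | zero => simp
    | add u v hu hv =>
      simp only [map_add, TensorProduct.tmul_add, hu, hv, Finset.sum_add_distrib]
    | tmul x y =>
      simp only [TensorProduct.sum_tmul, map_sum]
      refine Finset.sum_congr rfl fun i _ => ?_
      simp only [TensorProduct.AlgebraTensorModule.tensorTensorTensorComm_tmul,
        LinearMap.rTensor_tmul, LinearMap.lTensor_tmul, mulTwist_tmul]
      induction comul (R := R) y with
      | zero => simp
      | add u v hu hv => simp only [map_add, TensorProduct.tmul_add, hu, hv]
      | tmul c d => simp [F]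
  rw [h2, h3, Coalgebra.coassoc_apply]

end CrossedSection

/-! ### The smash product as an algebra of `A`-linear endomorphisms. -/

section CrossedSmash

variable {R H A : Type*} [CommRing R] [Ring H] [HopfAlgebra R H] [Ring A] [Algebra R A]
  (α : WeakAction R H A) (σ : H ⊗[R] H →ₗ[R] A)

/-- If `σ` is convolution invertible, then so is `h ↦ 1 # h`. -/
lemma isUnit_crossedSection [IsCrossedProduct α σ] (hσ : IsUnit (toConv σ)) :
    IsUnit (toConv (crossedSection α σ)) := by
  rw [← mulTwist_bijective_iff]
  let e : A ⊗[R] (H ⊗[R] H) ≃ₗ[R] CrossedProduct α σ ⊗[R] H :=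
    (TensorProduct.assoc R A H H).symm ≪≫ₗ (CrossedProduct.ofTensor α σ).rTensor H
  let e₁ := LinearEquiv.ofBijective _ (mulTwist_bijective_iff.2 hσ)
  let e₂ := LinearEquiv.ofBijective _ (mulTwist_bijective_iff.2 (isUnit_toConv_id (R := R) (H := H)))
  -- Here `e₁` comes from the invertibility of `σ` and `e₂` from the antipode, as the convolution
  -- inverse of `id_H`.
  convert (e.symm ≪≫ₗ e₁ ≪≫ₗ e₂.lTensor A ≪≫ₗ e).bijective using 1
  ext x
  obtain ⟨x, rfl⟩ := e.surjective x
  refine (mulTwist_crossedSection α σ x).trans ?_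
  simp only [LinearEquiv.trans_apply, LinearEquiv.symm_apply_apply]
  rfl

namespace CrossedProduct

instance : Module A (CrossedProduct α σ) := inferInstanceAs (Module A (A ⊗[R] H))

instance : IsScalarTower R A (CrossedProduct α σ) := inferInstanceAs (IsScalarTower R A (A ⊗[R] H))

instance : SMulCommClass A R (CrossedProduct α σ) := inferInstanceAs (SMulCommClass A R (A ⊗[R] H))

lemma smul_ofTensor_tmul (a b : A) (h : H) :
    a • ofTensor α σ (b ⊗ₜ h) = ofTensor α σ ((a * b) ⊗ₜ h) := rfl

@[elab_as_elim]
lemma induction_on {p : CrossedProduct α σ → Prop} (x : CrossedProduct α σ)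
    (tmul : ∀ a h, p (ofTensor α σ (a ⊗ₜ h))) (add : ∀ x y, p x → p y → p (x + y)) : p x := by
  obtain ⟨z, rfl⟩ := (ofTensor α σ).surjective x
  induction z with
  | zero => simpa using tmul 0 0
  | add u v hu hv => rw [map_add]; exact add _ _ hu hv
  | tmul a h => exact tmul a h

instance [IsCrossedProduct α σ] : IsScalarTower A (CrossedProduct α σ) (CrossedProduct α σ) where
  smul_assoc a x y := by
    simp only [smul_eq_mul]
    induction x using induction_on with
    | add u v hu hv => simp only [smul_add, add_mul, hu, hv]
    | tmul b h =>
    induction y using induction_on with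
    | add u v hu hv => simp only [smul_add, mul_add, hu, hv]
    | tmul c k =>
    have h1 : ∀ w : H ⊗[R] H, ofTensor α σ (crossedAux α σ (a * b) c k w) =
        a • ofTensor α σ (crossedAux α σ b c k w) := by
      intro w
      induction w with
      | zero => simp
      | add u v hu hv => simp only [map_add, smul_add, hu, hv]
      | tmul p q =>
        rw [crossedAux_tmul, crossedAux_tmul]
        induction cocycleMap σ (q ⊗ₜ k) with
        | zero => simp
        | add u v hu hv => simp only [map_add, mul_add, smul_add, hu, hv]
        | tmul d l => simp [smul_ofTensor_tmul, mul_assoc]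
    rw [smul_ofTensor_tmul, mul_def, mul_def]
    simp only [LinearEquiv.symm_apply_apply, crossedMul_tmul, h1]

/-- The translations of a crossed product are left linear. -/
lemma translate_smul [IsCrossedProduct α σ] (g : H →ₗ[R] R) (a : A) (x : CrossedProduct α σ) :
    translate g (a • x) = a • translate g x := by
  induction x using induction_on with
  | add u v hu hv => simp only [smul_add, map_add, hu, hv]
  | tmul b h =>
    rw [smul_ofTensor_tmul, translate_apply, translate_apply, coaction_eq_crossedCoaction,
      coaction_eq_crossedCoaction, crossedCoaction_tmul α σ _ (ℛ R h),
      crossedCoaction_tmul α σ _ (ℛ R h)]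
    simp [Finset.smul_sum, ← smul_ofTensor_tmul, smul_comm a]

variable [Module.Free R H] [Module.Finite R H] [IsCrossedProduct α σ]

/-- The right action of `(A #_σ H) # H^*` on `A #_σ H`, as a map to the `A`-linear endomorphisms. -/
def smashEnd : CrossedProduct α σ ⊗[R] (H →ₗ[R] R) →ₗ[R] Module.End A (CrossedProduct α σ) where
  toFun z :=
    { smashRight z with
      map_smul' := fun a x => by
        change smashRight z (a • x) = a • smashRight z x
        induction z with
        | zero => simp
        | add u v hu hv => simp only [map_add, LinearMap.add_apply, smul_add, hu, hv]
        | tmul b f => rw [smashRight_tmul, smashRight_tmul, smul_mul_assoc, translate_smul] }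
  map_add' u v := by ext x; exact LinearMap.congr_fun (map_add smashRight u v) x
  map_smul' r v := by ext x; exact LinearMap.congr_fun (map_smul smashRight r v) x

lemma smashEnd_apply (z : CrossedProduct α σ ⊗[R] (H →ₗ[R] R)) (x : CrossedProduct α σ) :
    smashEnd α σ z x = smashRight z x := rfl

/-- Restriction along `h ↦ 1 # h` reduces this to `smashRight_comp_bijective`: since `a # k = a • (1
# k)`, an `A`-linear map is determined by its values on the section. -/
lemma smashEnd_bijective (hσ : IsUnit (toConv σ)) : Function.Bijective (smashEnd α σ) := by
  have h := smashRight_comp_bijective _ (coaction_crossedSection α σ)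
    (isUnit_crossedSection α σ hσ)
  refine ⟨fun u v huv => h.1 ?_, fun f => ?_⟩
  · ext k
    exact LinearMap.congr_fun huv _
  · obtain ⟨z, hz⟩ := h.2 (f.restrictScalars R ∘ₗ crossedSection α σ)
    refine ⟨z, LinearMap.ext fun x => ?_⟩
    induction x using induction_on with
    | add u v hu hv => simp only [map_add, hu, hv]
    | tmul a k =>
      have h1 : ofTensor α σ (a ⊗ₜ k) = a • crossedSection α σ k := by
        rw [crossedSection_apply, smul_ofTensor_tmul, mul_one]
      rw [h1, map_smul, map_smul]
      exact congrArg _ (LinearMap.congr_fun hz k)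

lemma smashEnd_one : smashEnd α σ (1 ⊗ₜ counit) = LinearMap.id := by
  ext x
  rw [smashEnd_apply, smashRight_one]
  rfl

lemma smashEnd_smashMul (u v : CrossedProduct α σ ⊗[R] (H →ₗ[R] R)) :
    smashEnd α σ (smashMul R H (CrossedProduct α σ) u v) = smashEnd α σ v ∘ₗ smashEnd α σ u := by
  ext x
  rw [smashEnd_apply, smashRight_smashMul]
  rfl

/-- The matrices of the right action of `(A #_σ H) # H^*` in coordinates `e` of the left `A`-module
`A #_σ H`. -/
def smashMatrix {n : ℕ} (e : CrossedProduct α σ ≃ₗ[A] (Fin n → A)) :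
    SmashProduct R H (CrossedProduct α σ) →ₐ[R] Matrix (Fin n) (Fin n) A :=
  AlgHom.ofLinearMap
    (rowMatrix e ∘ₗ smashEnd α σ ∘ₗ
      (SmashProduct.ofTensor R H (CrossedProduct α σ)).symm.toLinearMap)
    (by
      rw [← rowMatrix_id (R := R) e, ← smashEnd_one α σ]
      rfl)
    (fun u v => by
      rw [SmashProduct.mul_def]
      simp only [LinearMap.comp_apply, LinearEquiv.coe_coe, LinearEquiv.symm_apply_apply]
      -- Two reversals cancel: the smash product acts on the right, and the matrices act on row
      -- vectors.
      rw [smashEnd_smashMul, rowMatrix_comp])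

lemma smashMatrix_bijective {n : ℕ} (e : CrossedProduct α σ ≃ₗ[A] (Fin n → A))
    (hσ : IsUnit (toConv σ)) : Function.Bijective (smashMatrix α σ e) :=
  (rowMatrix_bijective (R := R) e).comp
    ((smashEnd_bijective α σ hσ).comp
      (SmashProduct.ofTensor R H (CrossedProduct α σ)).symm.bijective)

/-- The coordinates on the left `A`-module `A #_σ H` given by a basis of `H`. -/
def coordinates {n : ℕ} (b : Module.Basis (Fin n) R H) : CrossedProduct α σ ≃ₗ[A] (Fin n → A) :=
  (Algebra.TensorProduct.basis A b).equivFun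

end CrossedProduct

end CrossedSmash

end HopfCrossed

end

theorem mainTheorem8 {R H A : Type*} [CommRing R] [Ring H] [HopfAlgebra R H]
    [Ring A] [Algebra R A] (n : ℕ) [Module.Free R H] [Module.Finite R H]
    (hn : Module.finrank R H = n)
    (α : HopfCrossed.WeakAction R H A)
    (σ : TensorProduct R H H →ₗ[R] A)
    [HopfCrossed.IsCrossedProduct α σ]
    (hσ : IsUnit (WithConv.toConv σ)) :
    Nonempty (HopfCrossed.SmashProduct R H (HopfCrossed.CrossedProduct α σ) ≃ₐ[R]
      TensorProduct R A (Matrix (Fin n) (Fin n) R)) ∧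
    Nonempty (TensorProduct R A (Matrix (Fin n) (Fin n) R) ≃ₐ[R] Matrix (Fin n) (Fin n) A) := by
  refine ⟨?_, ⟨(matrixEquivTensor (Fin n) R A).symm⟩⟩
  -- A basis indexed by `Fin n` is extracted from the rank only over a nontrivial ring; over the
  -- zero ring both algebras are trivial.
  cases subsingleton_or_nontrivial R with
  | inl _ =>
    have := Module.subsingleton R (HopfCrossed.SmashProduct R H (HopfCrossed.CrossedProduct α σ))
    have := Module.subsingleton R (TensorProduct R A (Matrix (Fin n) (Fin n) R))
    exact ⟨AlgEquiv.ofBijective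
      (AlgHom.ofLinearMap 0 (Subsingleton.elim _ _) fun _ _ => Subsingleton.elim _ _)
      ⟨fun _ _ _ => Subsingleton.elim _ _, fun _ => ⟨0, Subsingleton.elim _ _⟩⟩⟩
  | inr _ =>
    exact ⟨(AlgEquiv.ofBijective _ (HopfCrossed.CrossedProduct.smashMatrix_bijective α σ
      (HopfCrossed.CrossedProduct.coordinates α σ (Module.finBasisOfFinrankEq R H hn)) hσ)).trans
      (matrixEquivTensor (Fin n) R A)⟩
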